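/- \textbf{Setting.} The sites of a lattice system form a finite metric space $\Lambda$, and each site $x$ carries a finite-dimensional Hilbert space. Let $G$ be an abelian group with on-site linear unitary representations $g\mapsto u_x(g)$. For a region $X\subseteq\Lambda$ and a charge $\kappa$ (a one-dimensional unitary representation of $G$) let $\Pi^{(X)}_\kappa$ be the orthogonal projector onto the vectors $\psi$ of the whole system with $\bigotimes_{x\in X}u_x(g)\,\psi=\kappa(g)\psi$ for all $g\in G$. For pairwise disjoint regions $A,B,C$ and a state (density operator) $\rho$ put $$\Omega^{(AB|C)}(\rho)=\sum_{\kappa}|\kappa\rangle\langle\kappa|^{(K_C)}\otimes \mathrm{tr}_{\overline{AB}}\bigl(\Pi^{(C)}_\kappa\rho\bigr),$$ where $\kappa$ runs over the finitely many charges that occur in $C$, the vectors $|\kappa\rangle$ are an orthonormal basis of a register $K_C$, and the trace is over all sites outside $A\cup B$. Let $\mathrm{dist}(X,Y)$ be the least distance of a point of $X$ from a point of $Y$ ($+\infty$ if $X$ or $Y$ is empty), and let $X_l$ be the set of sites at distance at most $l$ from some point of $X$. A \emph{symmetric circuit with range bounded by $R$} is a product $V$ of finitely many layers; each layer is a product of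 unitaries that act on pairwise disjoint regions of diameter at most $r$ and commute with $\bigotimes_{x\in\Lambda}u_x(g)$ for all $g$, and (number of layers)$\,\cdot\, r\le R$. \textbf{Theorem.} Let $A,B,C$ be pairwise disjoint regions, let $D$ be the complement of $A\cup B\cup C$, and let $V$ be a symmetric circuit with range bounded by $R\ge 0$. If $D$ is non-empty, assume $\mathrm{dist}(D,C)>2R$. Then for every $l$ with $2R<l<\mathrm{dist}(A,B)/2$ and every state $\rho$, $$\Omega^{(A_lB_l|\tilde C_l)}(V\rho V^\dagger)\xrightarrow{\ \mathrm{LOCC}\ }\Omega^{(AB|C)}(\rho),\qquad \tilde C_l=C\setminus(A_l\cup B_l),$$ that is, the second state is obtained from the first by a finite protocol of local operations and classical communication. This holds both when the registers are held by the first party (partitions $A_lK_{\tilde C_l}|B_l$ and $AK_C|B$) and when they are held by the second party (partitions $A_l|K_{\tilde C_l}B_l$ and $A|K_CB$). -/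

import Mathlib

open Matrix
open scoped Kronecker NNReal ENNReal ComplexOrder

universe v

/-! ### Regions of a finite lattice and many-body operators

The sites form a finite metric space `Λ`; the site `x` carries a Hilbert space with orthonormal
basis `s x`.  A region is a finite set of sites.  Operators on the whole system are matrices
indexed by the product basis `∀ x, s x`. -/

section Lattice

variable {Λ : Type v} [Fintype Λ] [DecidableEq Λ]

/-- Distance of two regions (infinite if one of them is empty). -/
noncomputable def regionDist [MetricSpace Λ] (X Y : Finset Λ) : ℝ≥0∞ :=
  ⨅ x ∈ X, ⨅ y ∈ Y, edist x y

open Classical in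
/-- The ball of radius `l` about the region `X`. -/
noncomputable def regionBall [MetricSpace Λ] (X : Finset Λ) (l : ℝ≥0) : Finset Λ :=
  Finset.univ.filter (fun y => ∃ x ∈ X, edist y x ≤ (l : ℝ≥0∞))

/-- Product basis of the Hilbert space of the region `X`. -/
abbrev Conf (s : Λ → Type v) (X : Finset Λ) : Type v := ∀ x : X, s x

variable {s : Λ → Type v} [∀ x, Fintype (s x)] [∀ x, DecidableEq (s x)]

/-- The operator `w ⊗ 1` on the whole system, where `w` acts on the region `X` and the identity
acts on all the other sites. -/
def extendOp (X : Finset Λ) (w : Matrix (Conf s X) (Conf s X) ℂ) :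
    Matrix (∀ x, s x) (∀ x, s x) ℂ :=
  fun σ τ => if ∀ x, x ∉ X → σ x = τ x then w (fun x => σ x) (fun x => τ x) else 0

/-- The operator `M` acts only on the sites in `X`. -/
def IsSupportedOn (X : Finset Λ) (M : Matrix (∀ x, s x) (∀ x, s x) ℂ) : Prop :=
  ∃ w : Matrix (Conf s X) (Conf s X) ℂ, M = extendOp X w

/-- The basis vector of the whole system that restricts to `a` on `A`, to `b` on `B` and to `c`
on the other sites (used for disjoint `A`, `B`). -/
def glue (A B : Finset Λ) (a : Conf s A) (b : Conf s B) (c : Conf s (A ∪ B)ᶜ) : ∀ x, s x :=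
  fun x =>
    if hA : x ∈ A then a ⟨x, hA⟩
    else if hB : x ∈ B then b ⟨x, hB⟩
    else c ⟨x, by simp [hA, hB]⟩

/-- The partial trace over all sites except those in the disjoint regions `A` and `B`. -/
def reduceTo (A B : Finset Λ) (M : Matrix (∀ x, s x) (∀ x, s x) ℂ) :
    Matrix (Conf s A × Conf s B) (Conf s A × Conf s B) ℂ :=
  fun p q => ∑ c : Conf s (A ∪ B)ᶜ, M (glue A B p.1 p.2 c) (glue A B q.1 q.2 c)

/-- A density operator. -/
def IsState {n : Type v} [Fintype n] (ρ : Matrix n n ℂ) : Prop :=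
  ρ.PosSemidef ∧ ρ.trace = 1

/-! ### Abelian symmetry and charges -/

variable {G : Type v} [CommGroup G]

/-- The symmetry restricted to the region `X`: `⨂_{x ∈ X} u_x(g)`, times the identity on the
other sites. -/
def regionSymm (u : ∀ x, G →* Matrix.unitaryGroup (s x) ℂ) (X : Finset Λ) (g : G) :
    Matrix (∀ x, s x) (∀ x, s x) ℂ :=
  extendOp X (Matrix.of fun a b => ∏ x : X, (u x g).1 (a x) (b x))

/-- The subspace of vectors having charge `κ` in the region `X`; a charge is a one-dimensional
unitary representation of `G`. -/
noncomputable def chargeSubspace (u : ∀ x, G →* Matrix.unitaryGroup (s x) ℂ) (X : Finset Λ)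
    (κ : G →* Circle) : Submodule ℂ (EuclideanSpace ℂ (∀ x, s x)) :=
  ⨅ g : G, Module.End.eigenspace
    (Matrix.toEuclideanCLM (𝕜 := ℂ) (regionSymm u X g) :
      EuclideanSpace ℂ (∀ x, s x) →ₗ[ℂ] EuclideanSpace ℂ (∀ x, s x)) (κ g : ℂ)

/-- The orthogonal projector `Π_κ` onto the vectors of charge `κ` in the region `X`. -/
noncomputable def chargeProj (u : ∀ x, G →* Matrix.unitaryGroup (s x) ℂ) (X : Finset Λ)
    (κ : G →* Circle) : Matrix (∀ x, s x) (∀ x, s x) ℂ :=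
  (Matrix.toEuclideanCLM (n := ∀ x, s x) (𝕜 := ℂ)).symm (chargeSubspace u X κ).starProjection

/-- Labels of the orthonormal basis of the register: the charges that occur in the region `X`. -/
def Register (u : ∀ x, G →* Matrix.unitaryGroup (s x) ℂ) (X : Finset Λ) : Type v :=
  {κ : G →* Circle // chargeSubspace u X κ ≠ ⊥}

noncomputable instance (u : ∀ x, G →* Matrix.unitaryGroup (s x) ℂ) (X : Finset Λ) :
    DecidableEq (Register u X) := Classical.decEq _

theorem extendOp_mul (X : Finset Λ) (w v : Matrix (Conf s X) (Conf s X) ℂ) :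
    extendOp X w * extendOp X v = extendOp X (w * v) := by
  classical
  ext σ τ
  simp only [Matrix.mul_apply, extendOp]
  split_ifs with h
  · symm
    apply Finset.sum_bij_ne_zero
      (fun (c : Conf s X) _ _ => (fun x => if hx : x ∈ X then c ⟨x, hx⟩ else τ x : ∀ x, s x))
    · intros; simp
    · intro c _ _ d _ _ hcd
      funext x
      simpa using congrFun hcd x
    · intro υ _ hυ
      have h1 : ∀ x, x ∉ X → σ x = υ x := by
        by_contra hc; simp [hc] at hυ
      have h2 : ∀ x, x ∉ X → υ x = τ x := by
        by_contra hc; simp [hc] at hυ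
      refine ⟨fun x => υ x, Finset.mem_univ _, ?_, ?_⟩
      · rw [if_pos h1, if_pos h2] at hυ
        exact hυ
      · funext x
        by_cases hx : x ∈ X
        · simp [hx]
        · simp [hx, h2 x hx]
    · intro c _ _
      have h1 : ∀ x, x ∉ X → σ x = if hx : x ∈ X then c ⟨x, hx⟩ else τ x := by
        intro x hx; simp [hx, h x hx]
      have h2 : ∀ x, x ∉ X → (if hx : x ∈ X then c ⟨x, hx⟩ else τ x) = τ x := by
        intro x hx; simp [hx]
      rw [if_pos h1, if_pos h2]
      congr 2 <;> · funext x; simp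
  · apply Finset.sum_eq_zero
    intro υ _
    by_cases h1 : ∀ x, x ∉ X → σ x = υ x
    · by_cases h2 : ∀ x, x ∉ X → υ x = τ x
      · exact absurd (fun x hx => (h1 x hx).trans (h2 x hx)) h
      · rw [if_neg h2, mul_zero]
    · rw [if_neg h1, zero_mul]

theorem regionSymm_mul (u : ∀ x, G →* Matrix.unitaryGroup (s x) ℂ) (X : Finset Λ) (g h : G) :
    regionSymm u X g * regionSymm u X h = regionSymm u X (g * h) := by
  rw [regionSymm, regionSymm, regionSymm, extendOp_mul]
  congr 1
  ext a b
  simp only [Matrix.mul_apply, map_mul, Submonoid.coe_mul, Matrix.of_apply]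
  rw [Finset.prod_univ_sum]
  simp [Finset.prod_mul_distrib]

/-- Only finitely many charges occur. -/
theorem finite_register (u : ∀ x, G →* Matrix.unitaryGroup (s x) ℂ) (X : Finset Λ) :
    Finite (Register u X) := by
  let f : G → Module.End ℂ (EuclideanSpace ℂ (∀ x, s x)) := fun g =>
    (Matrix.toEuclideanCLM (𝕜 := ℂ) (regionSymm u X g) :
      EuclideanSpace ℂ (∀ x, s x) →ₗ[ℂ] EuclideanSpace ℂ (∀ x, s x))
  have hcomm : ∀ g h, Commute (f g) (f h) := by
    intro g h
    have key : Commute (Matrix.toEuclideanCLM (𝕜 := ℂ) (regionSymm u X g))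
        (Matrix.toEuclideanCLM (𝕜 := ℂ) (regionSymm u X h)) := by
      unfold Commute SemiconjBy
      rw [← map_mul, ← map_mul, regionSymm_mul, regionSymm_mul, mul_comm]
    exact LinearMap.ext fun z => congrArg (fun T => T z) key.eq
  have hind := Module.End.independent_iInf_maxGenEigenspace_of_forall_mapsTo f
    (fun i j φ => Module.End.mapsTo_maxGenEigenspace_of_comm (hcomm j i) φ)
  have hind2 : iSupIndep (fun κ : Register u X => chargeSubspace u X κ.1) := by
    have hinj : Function.Injective (fun (κ : Register u X) (g : G) => (κ.1 g : ℂ)) := by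
      intro κ κ' h
      apply Subtype.ext
      ext g
      exact congrFun h g
    refine (hind.comp hinj).mono ?_
    intro κ
    exact iInf_mono fun g => Module.End.genEigenspace (f g) _ |>.mono le_top
  exact WellFoundedGT.finite_of_iSupIndep hind2 (fun κ => κ.2)

noncomputable instance (u : ∀ x, G →* Matrix.unitaryGroup (s x) ℂ) (X : Finset Λ) :
    Fintype (Register u X) :=
  haveI := finite_register u X
  Fintype.ofFinite _

/-- The state `Ω^{(AB|C)}(ρ) = ∑_κ |κ⟩⟨κ| ⊗ tr_{rest}(Π_κ^{(C)} ρ)` of the register of `C` and the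
regions `A` and `B`. -/
noncomputable def Omega (u : ∀ x, G →* Matrix.unitaryGroup (s x) ℂ) (A B C : Finset Λ)
    (ρ : Matrix (∀ x, s x) (∀ x, s x) ℂ) :
    Matrix (Register u C × (Conf s A × Conf s B)) (Register u C × (Conf s A × Conf s B)) ℂ :=
  ∑ κ : Register u C, Matrix.single κ κ (1 : ℂ) ⊗ₖ reduceTo A B (chargeProj u C κ.1 * ρ)

/-! ### Symmetric circuits -/

/-- A symmetric unitary acting on the region `S` of diameter at most `r`. -/
def IsSymmetricGate [MetricSpace Λ] (u : ∀ x, G →* Matrix.unitaryGroup (s x) ℂ) (r : ℝ≥0)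
    (S : Finset Λ) (M : Matrix (∀ x, s x) (∀ x, s x) ℂ) : Prop :=
  M ∈ Matrix.unitaryGroup (∀ x, s x) ℂ ∧ IsSupportedOn S M ∧
    (∀ x ∈ S, ∀ y ∈ S, edist x y ≤ (r : ℝ≥0∞)) ∧
    ∀ g : G, Commute M (regionSymm u Finset.univ g)

/-- A product of symmetric unitaries which act on pairwise disjoint regions of diameter at
most `r`. -/
def IsSymmetricLayer [MetricSpace Λ] (u : ∀ x, G →* Matrix.unitaryGroup (s x) ℂ) (r : ℝ≥0)
    (L : Matrix (∀ x, s x) (∀ x, s x) ℂ) : Prop :=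
  ∃ gates : List (Finset Λ × Matrix (∀ x, s x) (∀ x, s x) ℂ),
    gates.Pairwise (fun p q => Disjoint p.1 q.1) ∧
    (∀ p ∈ gates, IsSymmetricGate u r p.1 p.2) ∧
    L = (gates.map Prod.snd).prod

/-- `V` is a symmetric circuit of range bounded by `R`: a product of layers of symmetric local
unitaries, whose number (the depth) times the maximal range of the unitaries is at most `R`. -/
def IsSymmetricCircuit [MetricSpace Λ] (u : ∀ x, G →* Matrix.unitaryGroup (s x) ℂ) (R : ℝ≥0)
    (V : Matrix (∀ x, s x) (∀ x, s x) ℂ) : Prop :=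
  ∃ (r : ℝ≥0) (layers : List (Matrix (∀ x, s x) (∀ x, s x) ℂ)),
    (∀ L ∈ layers, IsSymmetricLayer u r L) ∧
    (layers.length : ℝ≥0) * r ≤ R ∧ V = layers.prod

end Lattice

/-! ### Local operations and classical communication -/

/-- `IsLOCC a b Φ`: the map `Φ`, from operators of a bipartite system with local bases `a`, `b` to
operators of a bipartite system with local bases `a'`, `b'`, is realised by a finite LOCC protocol.
In every round one party performs a measurement with Kraus operators `K i`, `∑ i, (K i)ᴴ * K i = 1`
(which may change its local system), and communicates the outcome `i`, on which the rest of the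
protocol may depend; at the end the record of the outcomes is forgotten. -/
inductive IsLOCC {a' b' : Type v} :
    (a b : Type v) → [Fintype a] → [Fintype b] →
    (Matrix (a × b) (a × b) ℂ → Matrix (a' × b') (a' × b') ℂ) → Prop
  | done [Fintype a'] [Fintype b'] : IsLOCC a' b' (fun ρ => ρ)
  | alice {a b ι : Type v} [Fintype a] [Fintype b] [Fintype ι] [DecidableEq a] [DecidableEq b]
      {a₁ : ι → Type v} [∀ i, Fintype (a₁ i)]
      (K : ∀ i, Matrix (a₁ i) a ℂ) (hK : ∑ i, (K i)ᴴ * K i = 1)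
      (Φ : ∀ i, Matrix (a₁ i × b) (a₁ i × b) ℂ → Matrix (a' × b') (a' × b') ℂ)
      (hΦ : ∀ i, IsLOCC (a₁ i) b (Φ i)) :
      IsLOCC a b (fun ρ => ∑ i, Φ i ((K i ⊗ₖ (1 : Matrix b b ℂ)) * ρ *
        (K i ⊗ₖ (1 : Matrix b b ℂ))ᴴ))
  | bob {a b ι : Type v} [Fintype a] [Fintype b] [Fintype ι] [DecidableEq a] [DecidableEq b]
      {b₁ : ι → Type v} [∀ i, Fintype (b₁ i)]
      (K : ∀ i, Matrix (b₁ i) b ℂ) (hK : ∑ i, (K i)ᴴ * K i = 1)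
      (Φ : ∀ i, Matrix (a × b₁ i) (a × b₁ i) ℂ → Matrix (a' × b') (a' × b') ℂ)
      (hΦ : ∀ i, IsLOCC a (b₁ i) (Φ i)) :
      IsLOCC a b (fun ρ => ∑ i, Φ i (((1 : Matrix a a ℂ) ⊗ₖ K i) * ρ *
        ((1 : Matrix a a ℂ) ⊗ₖ K i)ᴴ))

/-- The bipartite state `ρ` can be converted to the bipartite state `ρ'` by LOCC. -/
def LOCCConvertible {a b a' b' : Type v} [Fintype a] [Fintype b]
    (ρ : Matrix (a × b) (a × b) ℂ) (ρ' : Matrix (a' × b') (a' × b') ℂ) : Prop :=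
  ∃ Φ : Matrix (a × b) (a × b) ℂ → Matrix (a' × b') (a' × b') ℂ, IsLOCC a b Φ ∧ Φ ρ = ρ'

/-- A state of a register `k` and systems `a`, `b`, seen as a bipartite state relative to the
partition `k a | b`. -/
def registerLeft {k a b : Type v} (M : Matrix (k × (a × b)) (k × (a × b)) ℂ) :
    Matrix ((k × a) × b) ((k × a) × b) ℂ :=
  M.submatrix (fun p => (p.1.1, (p.1.2, p.2))) (fun p => (p.1.1, (p.1.2, p.2)))

/-- A state of a register `k` and systems `a`, `b`, seen as a bipartite state relative to the
partition `a | k b`. -/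
def registerRight {k a b : Type v} (M : Matrix (k × (a × b)) (k × (a × b)) ℂ) :
    Matrix (a × (k × b)) (a × (k × b)) ℂ :=
  M.submatrix (fun p => (p.2.1, (p.1, p.2.2))) (fun p => (p.2.1, (p.1, p.2.2)))

/-!
A circuit `V` factorises as `V = W₁ W₂ Y`, where the unitaries `W₁`, `W₂` act near `A` and near `B`,
and `Y` commutes with all operators on `A`, with all operators on `B` and with the symmetry
restricted to `C` (`IsSymmetricCircuit.exists_factorisation`).  Indeed, layer by layer, the gates
which meet the current light cone of `A` or of `B` are absorbed into `W₁` or `W₂`, and these cones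
stay disjoint.  A remaining gate does not meet `A ∪ B`, and it is too short to connect `C` with `D`,
so that it lies inside `C` or outside `C`; being symmetric, it preserves the charge of `C`.

Therefore `Y ρ Yᴴ` and `ρ` have the same `Ω^{(AB|C)}`, and `W₁`, `W₂` can be undone locally.  It remains
to recover the charge of `C` from that of `C \ (A_l ∪ B_l)`.  The symmetry acts on site, hence it has a
product eigenbasis (`EigenFrame`), in which all charge projectors are diagonal.  The rest of `C` lies
in `(A_l \ A) ∪ (B_l \ B)`, sites which are discarded in the end.  So each party measures its part of
them in the eigenbasis, and the party which holds the register adds both charges to it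
(`locc_measure_and_relabel`).  That the result is `Ω^{(AB|C)}(ρ)` is checked against product
observables (`sum_bra_conj_reduceTo`).
-/

set_option linter.unusedSectionVars false

/-! ### Simultaneous diagonalisation of an abelian unitary representation -/

section Diagonalisation

variable {n : Type*} [Fintype n] [DecidableEq n] {G : Type*} [CommGroup G]

/-- The real part (for `false`) and the imaginary part (for `true`) of the unitaries `u g`, up to
a factor.  These Hermitian matrices commute, and they have the same joint eigenvectors as the
family `u`. -/
noncomputable def hermitianParts (u : G →* Matrix.unitaryGroup n ℂ) (p : G × Bool) :
    Matrix n n ℂ :=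
  if p.2 then Complex.I • ((u p.1 : Matrix n n ℂ) - (u p.1 : Matrix n n ℂ)ᴴ)
  else (u p.1 : Matrix n n ℂ) + (u p.1 : Matrix n n ℂ)ᴴ

lemma coe_inv_unitary (u : G →* Matrix.unitaryGroup n ℂ) (g : G) :
    ((u g⁻¹ : Matrix.unitaryGroup n ℂ) : Matrix n n ℂ) = (u g : Matrix n n ℂ)ᴴ := by
  rw [map_inv]; rfl

lemma hermitianParts_isHermitian (u : G →* Matrix.unitaryGroup n ℂ) (p : G × Bool) :
    (hermitianParts u p).IsHermitian := by
  obtain ⟨g, b⟩ := p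
  cases b
  · simp [hermitianParts, Matrix.IsHermitian, add_comm]
  · simp [hermitianParts, Matrix.IsHermitian, ← smul_neg]

lemma hermitianParts_commute (u : G →* Matrix.unitaryGroup n ℂ) (p q : G × Bool) :
    Commute (hermitianParts u p) (hermitianParts u q) := by
  have h : ∀ g h : G, Commute (u g : Matrix n n ℂ) (u h : Matrix n n ℂ) := by
    intro g h
    unfold Commute SemiconjBy
    rw [← Submonoid.coe_mul, ← Submonoid.coe_mul, ← map_mul, ← map_mul, mul_comm]
  obtain ⟨g, b⟩ := p
  obtain ⟨g', b'⟩ := q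
  cases b <;> cases b' <;> simp only [hermitianParts, ← coe_inv_unitary, if_true, if_false,
      Bool.false_eq_true]
  · exact ((h _ _).add_right (h _ _)).add_left ((h _ _).add_right (h _ _))
  · exact (((h _ _).sub_right (h _ _)).add_left ((h _ _).sub_right (h _ _))).smul_right _
  · exact (((h _ _).add_right (h _ _)).sub_left ((h _ _).add_right (h _ _))).smul_left _
  · exact ((((h _ _).sub_right (h _ _)).sub_left ((h _ _).sub_right (h _ _))).smul_left _).smul_right _

lemma exists_orthonormalBasis_joint_eigenvector (u : G →* Matrix.unitaryGroup n ℂ) :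
    ∃ b : OrthonormalBasis n ℂ (EuclideanSpace ℂ n),
      ∀ i g, ∃ c : ℂ, (u g : Matrix n n ℂ) *ᵥ (b i).ofLp = c • (b i).ofLp := by
  classical
  let T : G × Bool → EuclideanSpace ℂ n →ₗ[ℂ] EuclideanSpace ℂ n :=
    fun p => Matrix.toEuclideanLin (hermitianParts u p)
  have hT : ∀ p, (T p).IsSymmetric := fun p =>
    Matrix.isSymmetric_toEuclideanLin_iff.2 (hermitianParts_isHermitian u p)
  have hC : Pairwise (Function.onFun Commute T) := by
    intro p q _
    refine LinearMap.ext fun z => ?_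
    have := congrArg (fun M : Matrix n n ℂ => WithLp.toLp 2 (M *ᵥ z.ofLp))
      (hermitianParts_commute u p q).eq
    simpa [T, Matrix.toLpLin_apply, Matrix.mulVec_mulVec] using this
  let W : (G × Bool → ℂ) → Submodule ℂ (EuclideanSpace ℂ n) :=
    fun χ => ⨅ p, Module.End.eigenspace (T p) (χ p)
  have hO : OrthogonalFamily ℂ (fun χ => W χ) fun χ => (W χ).subtypeₗᵢ :=
    LinearMap.IsSymmetric.orthogonalFamily_iInf_eigenspaces hT
  -- Only finitely many joint eigenspaces are non-zero.
  let J := {χ // W χ ≠ ⊥}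
  have hO' : OrthogonalFamily ℂ (fun χ : J => W χ.1) fun χ => (W χ.1).subtypeₗᵢ :=
    hO.comp Subtype.val_injective
  have : Finite J := WellFoundedGT.finite_of_iSupIndep hO'.independent (fun χ => χ.2)
  have : Fintype J := Fintype.ofFinite J
  have hI : DirectSum.IsInternal (fun χ : J => W χ.1) := by
    rw [hO'.isInternal_iff, iSup_ne_bot_subtype,
      LinearMap.IsSymmetric.iSup_iInf_eq_top_of_commute hT hC, Submodule.top_orthogonal_eq_bot]
  have hn : Module.finrank ℂ (EuclideanSpace ℂ n) = Fintype.card n := finrank_euclideanSpace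
  refine ⟨(hI.subordinateOrthonormalBasis hn hO').reindex (Fintype.equivFin n).symm, ?_⟩
  intro i g
  set w := (hI.subordinateOrthonormalBasis hn hO').reindex (Fintype.equivFin n).symm i with hw
  have hmem : w ∈ W (hI.subordinateOrthonormalBasisIndex hn (Fintype.equivFin n i) hO').1 := by
    rw [hw, OrthonormalBasis.reindex_apply]
    exact hI.subordinateOrthonormalBasis_subordinate hn _ hO'
  generalize (hI.subordinateOrthonormalBasisIndex hn (Fintype.equivFin n i) hO').1 = χ at hmem
  have h1 := Module.End.mem_eigenspace_iff.1 ((Submodule.mem_iInf _).1 hmem (g, false))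
  have h2 := Module.End.mem_eigenspace_iff.1 ((Submodule.mem_iInf _).1 hmem (g, true))
  have h1' := congrArg WithLp.ofLp h1
  have h2' := congrArg WithLp.ofLp h2
  simp only [T, Matrix.toLpLin_apply, hermitianParts, WithLp.ofLp_smul, if_true,
    Bool.false_eq_true, if_false, Matrix.add_mulVec, Matrix.smul_mulVec, Matrix.sub_mulVec]
    at h1' h2'
  refine ⟨(χ (g, false) - Complex.I * χ (g, true)) / 2, ?_⟩
  funext x
  have e1 := congrFun h1' x
  have e2 := congrFun h2' x
  simp only [Pi.add_apply, Pi.smul_apply, Pi.sub_apply, smul_eq_mul] at e1 e2 ⊢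
  have hI2 : Complex.I * Complex.I = -1 := Complex.I_mul_I
  linear_combination (1 / 2 : ℂ) * e1 - (Complex.I / 2) * e2 +
    (1 / 2 : ℂ) * (((u g : Matrix n n ℂ) *ᵥ w.ofLp) x - ((u g : Matrix n n ℂ)ᴴ *ᵥ w.ofLp) x) * hI2

/-- An abelian unitary representation is diagonal in some orthonormal basis, the diagonal entries
being one-dimensional unitary representations. -/
theorem exists_unitary_diagonal (u : G →* Matrix.unitaryGroup n ℂ) :
    ∃ (w : Matrix n n ℂ) (χ : n → G →* Circle), wᴴ * w = 1 ∧ w * wᴴ = 1 ∧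
      ∀ g, (u g : Matrix n n ℂ) = w * diagonal (fun i => (χ i g : ℂ)) * wᴴ := by
  obtain ⟨b, hb⟩ := exists_orthonormalBasis_joint_eigenvector u
  choose c hc using hb
  set w : Matrix n n ℂ := Matrix.of fun i j => b j i with hw
  have hw1 : wᴴ * w = 1 := by
    ext i j
    have := (orthonormal_iff_ite.1 b.orthonormal) i j
    rw [Matrix.one_apply, ← this]
    simp [Matrix.mul_apply, hw, PiLp.inner_apply, mul_comm]
  have hw2 : w * wᴴ = 1 := mul_eq_one_comm.1 hw1
  have huw : ∀ g, (u g : Matrix n n ℂ) * w = w * diagonal (fun i => c i g) := by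
    intro g
    ext i j
    have := congrFun (hc j g) i
    simp only [Pi.smul_apply, smul_eq_mul, Matrix.mulVec, dotProduct] at this
    rw [Matrix.mul_diagonal, Matrix.mul_apply]
    simpa [hw, mul_comm] using this
  have hdiag : ∀ g, diagonal (fun i => c i g) = wᴴ * (u g : Matrix n n ℂ) * w := by
    intro g
    rw [Matrix.mul_assoc, huw, ← Matrix.mul_assoc, hw1, Matrix.one_mul]
  have hmul : ∀ i g h, c i (g * h) = c i g * c i h := by
    intro i g h
    have key : diagonal (fun i => c i (g * h)) =
        diagonal (fun i => c i g) * diagonal (fun i => c i h) := by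
      rw [hdiag h, ← Matrix.mul_assoc, ← Matrix.mul_assoc, hdiag g, hdiag (g * h), map_mul,
        Submonoid.coe_mul, Matrix.mul_assoc (wᴴ * (u g : Matrix n n ℂ)), hw2, Matrix.mul_one,
        ← Matrix.mul_assoc]
    rw [Matrix.diagonal_mul_diagonal] at key
    exact congrFun (Matrix.diagonal_injective key) i
  have hone : ∀ i, c i 1 = 1 := by
    intro i
    have key : diagonal (fun i => c i 1) = (1 : Matrix n n ℂ) := by
      rw [hdiag, map_one, Submonoid.coe_one, Matrix.mul_one, hw1]
    simpa using congrFun (congrFun key i) i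
  have hnorm : ∀ i g, ‖c i g‖ = 1 := by
    intro i g
    have key : (diagonal (fun i => c i g))ᴴ * diagonal (fun i => c i g) = (1 : Matrix n n ℂ) := by
      have hu : (u g : Matrix n n ℂ)ᴴ * (u g : Matrix n n ℂ) = 1 :=
        Matrix.UnitaryGroup.star_mul_self (u g)
      rw [hdiag]
      simp only [Matrix.conjTranspose_mul, Matrix.conjTranspose_conjTranspose, Matrix.mul_assoc]
      rw [← Matrix.mul_assoc w wᴴ, hw2, Matrix.one_mul, ← Matrix.mul_assoc _ _ w, hu,
        Matrix.one_mul, hw1]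
    have key' := congrFun (congrFun key i) i
    rw [Matrix.diagonal_conjTranspose, Matrix.diagonal_mul_diagonal, Matrix.diagonal_apply_eq,
      Matrix.one_apply_eq, Pi.star_apply, Complex.star_def, Complex.conj_mul'] at key'
    have : ‖c i g‖ ^ 2 = 1 := by exact_mod_cast key'
    exact (pow_eq_one_iff_of_nonneg (norm_nonneg _) two_ne_zero).1 this
  refine ⟨w, fun i =>
    { toFun := fun g => ⟨c i g, mem_sphere_zero_iff_norm.2 (hnorm i g)⟩
      map_one' := Circle.ext (hone i)
      map_mul' := fun g h => Circle.ext (hmul i g h) }, hw1, hw2, fun g => ?_⟩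
  have : (u g : Matrix n n ℂ) = w * diagonal (fun i => c i g) * wᴴ := by
    rw [← huw, Matrix.mul_assoc, hw2, Matrix.mul_one]
  exact this

end Diagonalisation

/-! ### Tensor products of on-site operators -/

section ProductOperators

variable {Λ : Type v} [Fintype Λ] [DecidableEq Λ]
variable {s : Λ → Type v} [∀ x, Fintype (s x)] [∀ x, DecidableEq (s x)]

/-- The operator `⨂_x m x` on the whole system. -/
def prodOp (m : ∀ x, Matrix (s x) (s x) ℂ) : Matrix (∀ x, s x) (∀ x, s x) ℂ :=
  Matrix.of fun σ τ => ∏ x, m x (σ x) (τ x)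

lemma prodOp_mul (m m' : ∀ x, Matrix (s x) (s x) ℂ) :
    prodOp m * prodOp m' = prodOp fun x => m x * m' x := by
  ext σ τ
  simp only [prodOp, Matrix.mul_apply, Matrix.of_apply, Fintype.prod_sum, Finset.prod_mul_distrib]

lemma prodOp_conjTranspose (m : ∀ x, Matrix (s x) (s x) ℂ) :
    (prodOp m)ᴴ = prodOp fun x => (m x)ᴴ := by
  ext σ τ
  simp [prodOp, Matrix.conjTranspose_apply]

lemma diagonal_prod_eq_prodOp (d : ∀ x, s x → ℂ) :
    diagonal (fun σ : ∀ x, s x => ∏ x, d x (σ x)) = prodOp fun x => diagonal (d x) := by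
  ext σ τ
  by_cases h : σ = τ
  · subst h; simp [prodOp]
  · obtain ⟨x, hx⟩ := Function.ne_iff.1 h
    rw [Matrix.diagonal_apply_ne _ h]
    exact (Finset.prod_eq_zero (Finset.mem_univ x)
      (Matrix.diagonal_apply_ne (d x) hx)).symm

lemma prodOp_one : prodOp (fun x => (1 : Matrix (s x) (s x) ℂ)) = 1 := by
  have := diagonal_prod_eq_prodOp (s := s) (fun _ _ => 1)
  simpa using this.symm

lemma extendOp_prod (X : Finset Λ) (m : ∀ x, Matrix (s x) (s x) ℂ) :
    extendOp X (Matrix.of fun a b => ∏ x : X, m x (a x) (b x)) =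
      prodOp fun x => if x ∈ X then m x else 1 := by
  ext σ τ
  simp only [extendOp, prodOp, Matrix.of_apply]
  rw [← Finset.prod_mul_prod_compl X]
  have h1 : ∏ x ∈ X, (if x ∈ X then m x else 1) (σ x) (τ x) = ∏ x : X, m x (σ x) (τ x) := by
    rw [← Finset.prod_coe_sort X]
    exact Finset.prod_congr rfl fun x _ => by rw [if_pos x.2]
  rw [h1]
  split_ifs with h
  · rw [Finset.prod_eq_one (s := Xᶜ), mul_one]
    intro x hx
    rw [Finset.mem_compl] at hx
    rw [if_neg hx, h x hx, Matrix.one_apply_eq]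
  · push Not at h
    obtain ⟨x, hx, hne⟩ := h
    rw [Finset.prod_eq_zero (Finset.mem_compl.2 hx), mul_zero]
    rw [if_neg hx, Matrix.one_apply_ne hne]

end ProductOperators

/-! ### Charges in an on-site eigenbasis -/

section Frame

variable {Λ : Type v} [Fintype Λ] [DecidableEq Λ]
variable {s : Λ → Type v} [∀ x, Fintype (s x)] [∀ x, DecidableEq (s x)]
variable {G : Type v} [CommGroup G]

/-- On every site an orthonormal eigenbasis of the symmetry: the columns of the unitary `basis x`
are the basis vectors, and `char x i` is the charge of the `i`-th one. -/
structure EigenFrame (u : ∀ x, G →* Matrix.unitaryGroup (s x) ℂ) where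
  basis : ∀ x, Matrix (s x) (s x) ℂ
  char : ∀ x, s x → G →* Circle
  star_mul : ∀ x, (basis x)ᴴ * basis x = 1
  mul_star : ∀ x, basis x * (basis x)ᴴ = 1
  eq : ∀ x g, (u x g : Matrix (s x) (s x) ℂ) =
    basis x * diagonal (fun i => (char x i g : ℂ)) * (basis x)ᴴ

theorem nonempty_eigenFrame (u : ∀ x, G →* Matrix.unitaryGroup (s x) ℂ) :
    Nonempty (EigenFrame u) := by
  choose w χ h1 h2 h3 using fun x => exists_unitary_diagonal (u x)
  exact ⟨⟨w, χ, h1, h2, h3⟩⟩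

namespace EigenFrame

variable {u : ∀ x, G →* Matrix.unitaryGroup (s x) ℂ} (F : EigenFrame u)

/-- The operator on the whole system which is diagonal, with diagonal entries `d`, in the product
of the on-site eigenbases. -/
noncomputable def op (d : (∀ x, s x) → ℂ) : Matrix (∀ x, s x) (∀ x, s x) ℂ :=
  prodOp F.basis * diagonal d * (prodOp F.basis)ᴴ

/-- The charge of a product of eigenvectors in the region `X`. -/
noncomputable def charge (X : Finset Λ) (σ : ∀ x, s x) : G →* Circle := ∏ x ∈ X, F.char x (σ x)

lemma basis_star_mul : (prodOp F.basis)ᴴ * prodOp F.basis = 1 := by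
  simp only [prodOp_conjTranspose, prodOp_mul, F.star_mul, prodOp_one]

lemma basis_mul_star : prodOp F.basis * (prodOp F.basis)ᴴ = 1 := mul_eq_one_comm.1 F.basis_star_mul

lemma op_mul (d e : (∀ x, s x) → ℂ) : F.op d * F.op e = F.op (fun σ => d σ * e σ) := by
  have : F.op d * F.op e = prodOp F.basis * (diagonal d * ((prodOp F.basis)ᴴ * prodOp F.basis) *
      diagonal e) * (prodOp F.basis)ᴴ := by
    simp only [op, Matrix.mul_assoc]
  rw [this, F.basis_star_mul, Matrix.mul_one, Matrix.diagonal_mul_diagonal, op]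

lemma op_one : F.op (fun _ => 1) = 1 := by
  rw [op, Matrix.diagonal_one, Matrix.mul_one, F.basis_mul_star]

lemma op_smul (c : ℂ) (d : (∀ x, s x) → ℂ) : F.op (fun σ => c * d σ) = c • F.op d := by
  have : (diagonal (fun σ => c * d σ) : Matrix (∀ x, s x) _ ℂ) = c • diagonal d := by
    rw [← Matrix.diagonal_smul]
    rfl
  rw [op, this, op, Matrix.mul_smul, Matrix.smul_mul]

lemma op_sum {ι : Type*} (t : Finset ι) (d : ι → (∀ x, s x) → ℂ) :
    ∑ i ∈ t, F.op (d i) = F.op (fun σ => ∑ i ∈ t, d i σ) := by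
  have : diagonal (fun σ => ∑ i ∈ t, d i σ) = ∑ i ∈ t, diagonal (d i) := by
    ext σ τ
    rw [Matrix.sum_apply]
    by_cases h : σ = τ <;> simp [h]
  rw [op, this, Matrix.mul_sum, Matrix.sum_mul]
  rfl

lemma op_conjTranspose (d : (∀ x, s x) → ℂ) : (F.op d)ᴴ = F.op (fun σ => star (d σ)) := by
  simp only [op, Matrix.conjTranspose_mul, Matrix.conjTranspose_conjTranspose,
    Matrix.diagonal_conjTranspose, Matrix.mul_assoc]
  rfl

lemma op_prod (d : ∀ x, s x → ℂ) :
    F.op (fun σ => ∏ x, d x (σ x)) =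
      prodOp fun x => F.basis x * diagonal (d x) * (F.basis x)ᴴ := by
  rw [op, diagonal_prod_eq_prodOp, prodOp_conjTranspose, prodOp_mul, prodOp_mul]

lemma charge_union {X Y : Finset Λ} (h : Disjoint X Y) (σ : ∀ x, s x) :
    F.charge (X ∪ Y) σ = F.charge X σ * F.charge Y σ := Finset.prod_union h

lemma charge_congr {X : Finset Λ} {σ τ : ∀ x, s x} (h : ∀ x ∈ X, σ x = τ x) :
    F.charge X σ = F.charge X τ := Finset.prod_congr rfl fun x hx => by rw [h x hx]

lemma regionSymm_eq_op (X : Finset Λ) (g : G) :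
    regionSymm u X g = F.op (fun σ => (F.charge X σ g : ℂ)) := by
  have h : (fun σ => (F.charge X σ g : ℂ)) =
      fun σ : ∀ x, s x => ∏ x, (if x ∈ X then fun i => (F.char x i g : ℂ) else 1) (σ x) := by
    funext σ
    rw [← Finset.prod_subset (Finset.subset_univ X) fun x _ hx => by simp [hx], charge,
      MonoidHom.finsetProd_apply]
    refine (map_prod Circle.coeHom _ _).trans ?_
    exact Finset.prod_congr rfl fun x hx => by rw [if_pos hx]; rfl
  rw [h, F.op_prod, regionSymm, extendOp_prod X fun x => (u x g).1]
  congr 1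
  funext x
  split_ifs
  · exact F.eq x g
  · rw [← F.mul_star x]
    simp

open Classical in
lemma mem_chargeSubspace_iff (X : Finset Λ) (κ : G →* Circle)
    (z : EuclideanSpace ℂ (∀ x, s x)) :
    z ∈ chargeSubspace u X κ ↔
      Matrix.toEuclideanCLM (𝕜 := ℂ) (F.op fun σ => if F.charge X σ = κ then 1 else 0) z = z := by
  have hiff : z ∈ chargeSubspace u X κ ↔ ∀ g, regionSymm u X g *ᵥ z.ofLp = (κ g : ℂ) • z.ofLp := by
    rw [chargeSubspace, Submodule.mem_iInf]
    refine forall_congr' fun g => ?_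
    rw [Module.End.mem_eigenspace_iff]
    exact ⟨fun h => congrArg WithLp.ofLp h, fun h => WithLp.ofLp_injective 2 h⟩
  have hiff2 : Matrix.toEuclideanCLM (𝕜 := ℂ)
      (F.op fun σ => if F.charge X σ = κ then 1 else 0) z = z ↔
      (F.op fun σ => if F.charge X σ = κ then 1 else 0) *ᵥ z.ofLp = z.ofLp :=
    ⟨fun h => congrArg WithLp.ofLp h, fun h => WithLp.ofLp_injective 2 h⟩
  rw [hiff, hiff2]
  constructor
  · intro h
    set y := (prodOp F.basis)ᴴ *ᵥ z.ofLp with hy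
    have hz : z.ofLp = prodOp F.basis *ᵥ y := by
      rw [hy, Matrix.mulVec_mulVec, F.basis_mul_star, Matrix.one_mulVec]
    have hy' : ∀ σ, F.charge X σ ≠ κ → y σ = 0 := by
      intro σ hσ
      obtain ⟨g, hg⟩ : ∃ g, F.charge X σ g ≠ κ g := by
        by_contra hc
        push Not at hc
        exact hσ (MonoidHom.ext hc)
      have h1 : diagonal (fun σ => (F.charge X σ g : ℂ)) *ᵥ y = (κ g : ℂ) • y := by
        have h2 := congrArg (fun t => (prodOp F.basis)ᴴ *ᵥ t) (h g)
        simp only [F.regionSymm_eq_op, op, Matrix.mulVec_mulVec, Matrix.mulVec_smul] at h2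
        rw [Matrix.mul_assoc, ← Matrix.mul_assoc, F.basis_star_mul, Matrix.one_mul,
          ← Matrix.mulVec_mulVec] at h2
        exact h2
      have h3 := congrFun h1 σ
      rw [Matrix.mulVec_diagonal, Pi.smul_apply, smul_eq_mul] at h3
      by_contra hne
      exact hg (Circle.ext (mul_right_cancel₀ hne h3))
    have hd : diagonal (fun σ => if F.charge X σ = κ then (1 : ℂ) else 0) *ᵥ y = y := by
      funext σ
      rw [Matrix.mulVec_diagonal]
      split_ifs with hσ
      · rw [one_mul]
      · rw [hy' σ hσ, mul_zero]
    rw [op, ← Matrix.mulVec_mulVec, ← hy, ← Matrix.mulVec_mulVec, hd, ← hz]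
  · intro h g
    rw [← h, Matrix.mulVec_mulVec, F.regionSymm_eq_op, F.op_mul, ← Matrix.smul_mulVec,
      ← F.op_smul]
    congr 2
    funext σ
    split_ifs with hσ
    · rw [hσ]
    · simp

open Classical in
/-- The charge projectors are diagonal in the product of the on-site eigenbases. -/
theorem chargeProj_eq_op (X : Finset Λ) (κ : G →* Circle) :
    chargeProj u X κ = F.op fun σ => if F.charge X σ = κ then 1 else 0 := by
  set P := F.op fun σ => if F.charge X σ = κ then 1 else 0 with hP
  have hPP : P * P = P := by
    rw [hP, F.op_mul]
    congr 1
    funext σ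
    split_ifs <;> simp
  have hPs : star P = P := by
    rw [Matrix.star_eq_conjTranspose, hP, F.op_conjTranspose]
    congr 1
    funext σ
    split_ifs <;> simp
  have hproj : IsStarProjection (Matrix.toEuclideanCLM (n := ∀ x, s x) (𝕜 := ℂ) P) :=
    ⟨by rw [IsIdempotentElem, ← map_mul, hPP], by rw [IsSelfAdjoint, ← map_star, hPs]⟩
  obtain ⟨K, _, hE⟩ := isStarProjection_iff_eq_starProjection.1 hproj
  have hK : chargeSubspace u X κ = K := by
    ext z
    rw [F.mem_chargeSubspace_iff, ← hP, hE, Submodule.starProjection_eq_self_iff]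
  subst hK
  rw [chargeProj, ← hE, StarAlgEquiv.symm_apply_apply]

lemma chargeSubspace_ne_bot_iff (X : Finset Λ) (κ : G →* Circle) :
    chargeSubspace u X κ ≠ ⊥ ↔ ∃ σ, F.charge X σ = κ := by
  classical
  have h0 : ∀ d, F.op d = 0 → d = 0 := by
    intro d hd
    have h1 : diagonal d = (prodOp F.basis)ᴴ * F.op d * prodOp F.basis := by
      rw [op, Matrix.mul_assoc, Matrix.mul_assoc, F.basis_star_mul, Matrix.mul_one,
        ← Matrix.mul_assoc, F.basis_star_mul, Matrix.one_mul]
    rw [hd, Matrix.mul_zero, Matrix.zero_mul] at h1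
    exact Matrix.diagonal_eq_zero.1 h1
  constructor
  · intro h
    by_contra! hc
    refine h ((Submodule.eq_bot_iff _).2 fun z hz => ?_)
    rw [F.mem_chargeSubspace_iff] at hz
    have h1 : (fun σ => if F.charge X σ = κ then (1 : ℂ) else 0) = fun _ => 0 * 1 := by
      funext σ
      simp [hc σ]
    rw [h1, F.op_smul, zero_smul, map_zero] at hz
    exact hz.symm
  · rintro ⟨σ, hσ⟩ h
    have h1 := F.chargeProj_eq_op X κ
    have h2 : chargeProj u X κ = 0 := by
      simp only [chargeProj, h, Submodule.starProjection_bot, map_zero]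
    rw [h2] at h1
    simpa [hσ] using congrFun (h0 _ h1.symm) σ

end EigenFrame

end Frame

/-! ### A two-round LOCC protocol acting on a classical register -/

section LOCC

variable {k k' a a' b b' ιA ιB : Type v} [Fintype k] [Fintype k'] [Fintype a] [Fintype a']
  [Fintype b] [Fintype b'] [Fintype ιA] [Fintype ιB] [DecidableEq k] [DecidableEq k']
  [DecidableEq a] [DecidableEq b]

/-- The Kraus operators `|f i⟩⟨i| ⊗ K j` form a measurement if the `K j` do. -/
lemma sum_single_kronecker_isometry (f : k → ιA → k') (K : ιA → Matrix a' a ℂ)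
    (hK : ∑ i, (K i)ᴴ * K i = 1) :
    ∑ p : k × ιA, (Matrix.single (f p.1 p.2) p.1 (1 : ℂ) ⊗ₖ K p.2)ᴴ *
      (Matrix.single (f p.1 p.2) p.1 (1 : ℂ) ⊗ₖ K p.2) = 1 := by
  have h : ∀ p : k × ιA, (Matrix.single (f p.1 p.2) p.1 (1 : ℂ) ⊗ₖ K p.2)ᴴ *
      (Matrix.single (f p.1 p.2) p.1 (1 : ℂ) ⊗ₖ K p.2) =
      Matrix.single p.1 p.1 (1 : ℂ) ⊗ₖ ((K p.2)ᴴ * K p.2) := by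
    intro p
    rw [Matrix.conjTranspose_kronecker, ← Matrix.mul_kronecker_mul, Matrix.conjTranspose_single,
      Matrix.single_mul_single_same]
    simp
  simp_rw [h, Fintype.sum_prod_type]
  ext ⟨c, x⟩ ⟨d, y⟩
  have h1 : ∑ i, ((K i)ᴴ * K i) x y = (1 : Matrix a a ℂ) x y := by
    rw [← hK, Matrix.sum_apply]
  simp only [Matrix.sum_apply, Matrix.kroneckerMap_apply, ← Finset.mul_sum, h1]
  rw [← Finset.sum_mul, ← Matrix.sum_apply, Matrix.sum_single_one, ← Matrix.one_kronecker_one,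
    Matrix.kroneckerMap_apply]

/-- Block computation behind the protocol: the Kraus operator `|c'⟩⟨c| ⊗ K` picks the block `c` of
a state whose register is classical, and relabels it `c'`. -/
lemma single_kronecker_mul_blocks (m : k → Matrix (a × b) (a × b) ℂ) (c : k) (c' : k')
    (K : Matrix (a' × b') (a × b) ℂ) :
    (Matrix.single c' c (1 : ℂ) ⊗ₖ K) * (∑ κ, Matrix.single κ κ (1 : ℂ) ⊗ₖ m κ) *
      (Matrix.single c' c (1 : ℂ) ⊗ₖ K)ᴴ =
    Matrix.single c' c' (1 : ℂ) ⊗ₖ (K * m c * Kᴴ) := by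
  rw [Matrix.mul_sum, Matrix.sum_mul, Finset.sum_eq_single c]
  · rw [Matrix.conjTranspose_kronecker, ← Matrix.mul_kronecker_mul, ← Matrix.mul_kronecker_mul,
      Matrix.conjTranspose_single]
    simp
  · intro d _ hd
    rw [← Matrix.mul_kronecker_mul, Matrix.single_mul_single_of_ne _ _ _ _ hd.symm,
      Matrix.zero_kronecker, Matrix.zero_mul]
  · simp

lemma registerLeft_sum {ι : Type*} (t : Finset ι) (M : ι → Matrix (k × (a × b)) (k × (a × b)) ℂ) :
    registerLeft (∑ i ∈ t, M i) = ∑ i ∈ t, registerLeft (M i) := by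
  ext p q
  simp [registerLeft, Matrix.sum_apply]

lemma registerRight_sum {ι : Type*} (t : Finset ι)
    (M : ι → Matrix (k × (a × b)) (k × (a × b)) ℂ) :
    registerRight (∑ i ∈ t, M i) = ∑ i ∈ t, registerRight (M i) := by
  ext p q
  simp [registerRight, Matrix.sum_apply]

lemma registerLeft_conj (S : Matrix k' k ℂ) (X : Matrix a' a ℂ) (Y : Matrix b' b ℂ)
    (M : Matrix (k × (a × b)) (k × (a × b)) ℂ) :
    ((S ⊗ₖ X) ⊗ₖ Y) * registerLeft M * ((S ⊗ₖ X) ⊗ₖ Y)ᴴ =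
      registerLeft ((S ⊗ₖ (X ⊗ₖ Y)) * M * (S ⊗ₖ (X ⊗ₖ Y))ᴴ) := by
  have h : (S ⊗ₖ X) ⊗ₖ Y = (S ⊗ₖ (X ⊗ₖ Y)).submatrix (Equiv.prodAssoc k' a' b')
      (Equiv.prodAssoc k a b) := by
    ext p q
    simp [Matrix.kroneckerMap_apply, mul_assoc]
  have h' : ∀ N : Matrix (k × (a × b)) (k × (a × b)) ℂ, registerLeft N =
    N.submatrix (Equiv.prodAssoc k a b) (Equiv.prodAssoc k a b) := fun _ => rfl
  rw [h, h', Matrix.conjTranspose_submatrix, Matrix.submatrix_mul_equiv,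
    Matrix.submatrix_mul_equiv]
  rfl

lemma registerRight_conj (S : Matrix k' k ℂ) (X : Matrix a' a ℂ) (Y : Matrix b' b ℂ)
    (M : Matrix (k × (a × b)) (k × (a × b)) ℂ) :
    (X ⊗ₖ (S ⊗ₖ Y)) * registerRight M * (X ⊗ₖ (S ⊗ₖ Y))ᴴ =
      registerRight ((S ⊗ₖ (X ⊗ₖ Y)) * M * (S ⊗ₖ (X ⊗ₖ Y))ᴴ) := by
  let e : a × (k × b) ≃ k × (a × b) :=
    ⟨fun p => (p.2.1, (p.1, p.2.2)), fun p => (p.2.1, (p.1, p.2.2)), fun _ => rfl, fun _ => rfl⟩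
  let e' : a' × (k' × b') ≃ k' × (a' × b') :=
    ⟨fun p => (p.2.1, (p.1, p.2.2)), fun p => (p.2.1, (p.1, p.2.2)), fun _ => rfl, fun _ => rfl⟩
  have h : X ⊗ₖ (S ⊗ₖ Y) = (S ⊗ₖ (X ⊗ₖ Y)).submatrix e' e := by
    ext p q
    simp [Matrix.kroneckerMap_apply, e, e', mul_left_comm]
  have h' : registerRight M = M.submatrix e e := rfl
  rw [h, h', Matrix.conjTranspose_submatrix, Matrix.submatrix_mul_equiv,
    Matrix.submatrix_mul_equiv]
  rfl

/-- Both parties measure, with Kraus operators `KA i` and `KB j`, and the label `c` of a classical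
register is changed to `f c i j`.  This is an LOCC protocol whichever party holds the register:
the other one measures first and communicates the outcome. -/
theorem locc_measure_and_relabel (m : k → Matrix (a × b) (a × b) ℂ) (KA : ιA → Matrix a' a ℂ)
    (KB : ιB → Matrix b' b ℂ) (hA : ∑ i, (KA i)ᴴ * KA i = 1) (hB : ∑ j, (KB j)ᴴ * KB j = 1)
    (f : k → ιA → ιB → k') :
    LOCCConvertible (registerLeft (∑ c, Matrix.single c c (1 : ℂ) ⊗ₖ m c))
        (registerLeft (∑ c, ∑ i, ∑ j, Matrix.single (f c i j) (f c i j) (1 : ℂ) ⊗ₖ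
          ((KA i ⊗ₖ KB j) * m c * (KA i ⊗ₖ KB j)ᴴ))) ∧
      LOCCConvertible (registerRight (∑ c, Matrix.single c c (1 : ℂ) ⊗ₖ m c))
        (registerRight (∑ c, ∑ i, ∑ j, Matrix.single (f c i j) (f c i j) (1 : ℂ) ⊗ₖ
          ((KA i ⊗ₖ KB j) * m c * (KA i ⊗ₖ KB j)ᴴ))) := by
  classical
  constructor
  · refine ⟨_, IsLOCC.bob (b₁ := fun _ => b') KB hB _ fun j =>
      IsLOCC.alice (ι := k × ιA) (a₁ := fun _ => k' × a')
        (fun p => Matrix.single (f p.1 p.2 j) p.1 (1 : ℂ) ⊗ₖ KA p.2)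
        (sum_single_kronecker_isometry (fun c i => f c i j) KA hA) _ fun _ => IsLOCC.done, ?_⟩
    have h : ∀ (j : ιB) (p : k × ιA),
        ((Matrix.single (f p.1 p.2 j) p.1 (1 : ℂ) ⊗ₖ KA p.2) ⊗ₖ (1 : Matrix b' b' ℂ)) *
          (((1 : Matrix (k × a) (k × a) ℂ) ⊗ₖ KB j) *
            registerLeft (∑ c, Matrix.single c c (1 : ℂ) ⊗ₖ m c) *
            ((1 : Matrix (k × a) (k × a) ℂ) ⊗ₖ KB j)ᴴ) *
          ((Matrix.single (f p.1 p.2 j) p.1 (1 : ℂ) ⊗ₖ KA p.2) ⊗ₖ (1 : Matrix b' b' ℂ))ᴴ =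
        registerLeft (Matrix.single (f p.1 p.2 j) (f p.1 p.2 j) (1 : ℂ) ⊗ₖ
          ((KA p.2 ⊗ₖ KB j) * m p.1 * (KA p.2 ⊗ₖ KB j)ᴴ)) := by
      intro j p
      have h1 : ((Matrix.single (f p.1 p.2 j) p.1 (1 : ℂ) ⊗ₖ KA p.2) ⊗ₖ (1 : Matrix b' b' ℂ)) *
          ((1 : Matrix (k × a) (k × a) ℂ) ⊗ₖ KB j) =
          (Matrix.single (f p.1 p.2 j) p.1 (1 : ℂ) ⊗ₖ KA p.2) ⊗ₖ KB j := by
        rw [← Matrix.mul_kronecker_mul, Matrix.mul_one, Matrix.one_mul]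
      rw [← single_kronecker_mul_blocks, ← registerLeft_conj, ← h1, Matrix.conjTranspose_mul]
      simp only [Matrix.mul_assoc]
    simp_rw [h, registerLeft_sum, Fintype.sum_prod_type]
    rw [Finset.sum_comm]
    exact Finset.sum_congr rfl fun c _ => Finset.sum_comm
  · refine ⟨_, IsLOCC.alice (a₁ := fun _ => a') KA hA _ fun i =>
      IsLOCC.bob (ι := k × ιB) (b₁ := fun _ => k' × b')
        (fun p => Matrix.single (f p.1 i p.2) p.1 (1 : ℂ) ⊗ₖ KB p.2)
        (sum_single_kronecker_isometry (fun c j => f c i j) KB hB) _ fun _ => IsLOCC.done, ?_⟩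
    have h : ∀ (i : ιA) (p : k × ιB),
        ((1 : Matrix a' a' ℂ) ⊗ₖ (Matrix.single (f p.1 i p.2) p.1 (1 : ℂ) ⊗ₖ KB p.2)) *
          ((KA i ⊗ₖ (1 : Matrix (k × b) (k × b) ℂ)) *
            registerRight (∑ c, Matrix.single c c (1 : ℂ) ⊗ₖ m c) *
            (KA i ⊗ₖ (1 : Matrix (k × b) (k × b) ℂ))ᴴ) *
          ((1 : Matrix a' a' ℂ) ⊗ₖ (Matrix.single (f p.1 i p.2) p.1 (1 : ℂ) ⊗ₖ KB p.2))ᴴ =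
        registerRight (Matrix.single (f p.1 i p.2) (f p.1 i p.2) (1 : ℂ) ⊗ₖ
          ((KA i ⊗ₖ KB p.2) * m p.1 * (KA i ⊗ₖ KB p.2)ᴴ)) := by
      intro i p
      have h1 : ((1 : Matrix a' a' ℂ) ⊗ₖ (Matrix.single (f p.1 i p.2) p.1 (1 : ℂ) ⊗ₖ KB p.2)) *
          (KA i ⊗ₖ (1 : Matrix (k × b) (k × b) ℂ)) =
          KA i ⊗ₖ (Matrix.single (f p.1 i p.2) p.1 (1 : ℂ) ⊗ₖ KB p.2) := by
        rw [← Matrix.mul_kronecker_mul, Matrix.mul_one, Matrix.one_mul]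
      rw [← single_kronecker_mul_blocks, ← registerRight_conj, ← h1, Matrix.conjTranspose_mul]
      simp only [Matrix.mul_assoc]
    simp_rw [h, registerRight_sum, Fintype.sum_prod_type]
    rw [Finset.sum_comm]

end LOCC

/-! ### Operators supported on a region -/

section Support

variable {Λ : Type v} [Fintype Λ] [DecidableEq Λ]
variable {s : Λ → Type v} [∀ x, Fintype (s x)] [∀ x, DecidableEq (s x)]

lemma extendOp_one (X : Finset Λ) : extendOp X (1 : Matrix (Conf s X) (Conf s X) ℂ) = 1 := by
  ext σ τ
  simp only [extendOp, Matrix.one_apply]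
  by_cases h : σ = τ
  · subst h; simp
  · rw [if_neg h]
    split_ifs with h1 h2
    · refine absurd (funext fun x => ?_) h
      by_cases hx : x ∈ X
      · exact congrFun h2 ⟨x, hx⟩
      · exact h1 x hx
    · rfl
    · rfl

lemma extendOp_conjTranspose (X : Finset Λ) (m : Matrix (Conf s X) (Conf s X) ℂ) :
    extendOp X mᴴ = (extendOp X m)ᴴ := by
  ext σ τ
  simp only [extendOp, Matrix.conjTranspose_apply, eq_comm (a := τ _)]
  split_ifs <;> simp

lemma extendOp_sum {ι : Type*} (t : Finset ι) (X : Finset Λ)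
    (m : ι → Matrix (Conf s X) (Conf s X) ℂ) :
    extendOp X (∑ i ∈ t, m i) = ∑ i ∈ t, extendOp X (m i) := by
  ext σ τ
  simp only [extendOp, Matrix.sum_apply]
  split_ifs <;> simp

/-- Without the hypothesis, the system could have no state on the sites outside `X`. -/
lemma extendOp_injective [Nonempty (∀ x, s x)] (X : Finset Λ) :
    Function.Injective (extendOp X : Matrix (Conf s X) (Conf s X) ℂ → _) := by
  intro m m' h
  obtain ⟨υ⟩ := ‹Nonempty (∀ x, s x)›
  ext a b
  have := congrFun (congrFun h (fun x => if hx : x ∈ X then a ⟨x, hx⟩ else υ x))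
    (fun x => if hx : x ∈ X then b ⟨x, hx⟩ else υ x)
  simp only [extendOp] at this
  rw [if_pos (fun x hx => by simp [hx]), if_pos (fun x hx => by simp [hx])] at this
  simpa using this

/-- The product of operators on two disjoint regions, in coordinates. -/
lemma extendOp_mul_extendOp_apply {X Y : Finset Λ} (hXY : Disjoint X Y)
    (m : Matrix (Conf s X) (Conf s X) ℂ) (m' : Matrix (Conf s Y) (Conf s Y) ℂ)
    (σ τ : ∀ x, s x) :
    (extendOp X m * extendOp Y m') σ τ =
      if ∀ x, x ∉ X → x ∉ Y → σ x = τ x then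
        m (fun x => σ x) (fun x => τ x) * m' (fun x => σ x) (fun x => τ x) else 0 := by
  have hd : ∀ x, x ∈ X → x ∈ Y → False := fun x h1 h2 => Finset.disjoint_left.1 hXY h1 h2
  rw [Matrix.mul_apply]
  -- The only intermediate configuration which contributes.
  rw [Finset.sum_eq_single (fun x => if x ∈ X then τ x else σ x)]
  · simp only [extendOp]
    rw [if_pos (fun x hx => by simp [hx])]
    have hc : (∀ x, x ∉ Y → (if x ∈ X then τ x else σ x) = τ x) ↔
        ∀ x, x ∉ X → x ∉ Y → σ x = τ x := by
      refine forall_congr' fun x => ?_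
      by_cases hx : x ∈ X <;> simp [hx]
    simp only [hc, mul_ite, mul_zero]
    congr 3
    · funext x; simp
    · funext x
      rw [if_neg (fun h => hd _ h x.2)]
  · intro υ _ hυ
    simp only [extendOp]
    by_contra hne
    have h1 : ∀ x, x ∉ X → σ x = υ x := by
      by_contra hc; rw [if_neg hc, zero_mul] at hne; exact hne rfl
    have h2 : ∀ x, x ∉ Y → υ x = τ x := by
      by_contra hc; rw [if_neg hc, mul_zero] at hne; exact hne rfl
    refine hυ (funext fun x => ?_)
    split_ifs with hx
    · exact h2 x (hd x hx)
    · exact (h1 x hx).symm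
  · simp

namespace IsSupportedOn

variable {X Y : Finset Λ} {M N : Matrix (∀ x, s x) (∀ x, s x) ℂ}

lemma one (X : Finset Λ) : IsSupportedOn (s := s) X 1 := ⟨1, (extendOp_one X).symm⟩

lemma mul (hM : IsSupportedOn X M) (hN : IsSupportedOn X N) : IsSupportedOn X (M * N) := by
  obtain ⟨m, rfl⟩ := hM
  obtain ⟨n, rfl⟩ := hN
  exact ⟨m * n, extendOp_mul X m n⟩

lemma conjTranspose (hM : IsSupportedOn X M) : IsSupportedOn X Mᴴ := by
  obtain ⟨m, rfl⟩ := hM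
  exact ⟨mᴴ, (extendOp_conjTranspose X m).symm⟩

lemma mono (hM : IsSupportedOn X M) (h : X ⊆ Y) : IsSupportedOn Y M := by
  obtain ⟨m, rfl⟩ := hM
  refine ⟨Matrix.of fun a b => if ∀ x : Y, x.1 ∉ X → a x = b x then
    m (fun x => a ⟨x, h x.2⟩) (fun x => b ⟨x, h x.2⟩) else 0, ?_⟩
  ext σ τ
  simp only [extendOp, Matrix.of_apply, Subtype.forall]
  by_cases h1 : ∀ x, x ∉ X → σ x = τ x
  · rw [if_pos h1, if_pos (fun x hx => h1 x fun hx' => hx (h hx')), if_pos fun x _ hx => h1 x hx]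
  · rw [if_neg h1]
    by_cases h2 : ∀ x, x ∉ Y → σ x = τ x
    · rw [if_pos h2, if_neg]
      refine fun h3 => h1 fun x hx => ?_
      by_cases hy : x ∈ Y
      · exact h3 x hy hx
      · exact h2 x hy
    · rw [if_neg h2]

lemma commute (hM : IsSupportedOn X M) (hN : IsSupportedOn Y N) (h : Disjoint X Y) :
    Commute M N := by
  obtain ⟨m, rfl⟩ := hM
  obtain ⟨n, rfl⟩ := hN
  ext σ τ
  rw [extendOp_mul_extendOp_apply h, extendOp_mul_extendOp_apply h.symm]
  simp only [mul_comm (m _ _)]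
  congr 1
  exact propext (forall_congr' fun x => by tauto)

end IsSupportedOn

lemma isSupportedOn_extendOp (X : Finset Λ) (m : Matrix (Conf s X) (Conf s X) ℂ) :
    IsSupportedOn X (extendOp X m) := ⟨m, rfl⟩

variable {G : Type v} [CommGroup G] {u : ∀ x, G →* Matrix.unitaryGroup (s x) ℂ}

lemma regionSymm_union {X Y : Finset Λ} (h : Disjoint X Y) (g : G) :
    regionSymm u (X ∪ Y) g = regionSymm u X g * regionSymm u Y g := by
  obtain ⟨F⟩ := nonempty_eigenFrame u
  simp only [F.regionSymm_eq_op, F.op_mul, F.charge_union h, MonoidHom.mul_apply, Circle.coe_mul]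

lemma regionSymm_isUnit (X : Finset Λ) (g : G) : IsUnit (regionSymm u X g) := by
  have h1 : regionSymm u X (1 : G) = 1 := by
    obtain ⟨F⟩ := nonempty_eigenFrame u
    rw [F.regionSymm_eq_op, ← F.op_one]
    simp
  refine IsUnit.of_mul_eq_one (regionSymm u X g⁻¹) ?_
  rw [regionSymm_mul, mul_inv_cancel, h1]

lemma isSupportedOn_regionSymm (X : Finset Λ) (g : G) : IsSupportedOn X (regionSymm u X g) :=
  isSupportedOn_extendOp X _

/-- A symmetric operator supported inside a region, or outside it, preserves the charge of this
region. -/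
lemma commute_regionSymm {S C : Finset Λ} {M : Matrix (∀ x, s x) (∀ x, s x) ℂ}
    (hM : IsSupportedOn S M) (hsym : ∀ g : G, Commute M (regionSymm u Finset.univ g))
    (h : S ⊆ C ∨ Disjoint S C) (g : G) : Commute M (regionSymm u C g) := by
  rcases h with h | h
  · have hco : Commute M (regionSymm u Cᶜ g) :=
      hM.commute (isSupportedOn_regionSymm _ g)
        (Finset.disjoint_left.2 fun x hx hx' => Finset.mem_compl.1 hx' (h hx))
    have huniv : regionSymm u Finset.univ g = regionSymm u C g * regionSymm u Cᶜ g := by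
      rw [← regionSymm_union disjoint_compl_right, Finset.union_compl]
    have h1 := (hsym g).eq
    rw [huniv, Matrix.mul_assoc, ← hco.eq, ← Matrix.mul_assoc, ← Matrix.mul_assoc] at h1
    exact (regionSymm_isUnit (u := u) Cᶜ g).mul_right_cancel h1
  · exact hM.commute (isSupportedOn_regionSymm _ g) h

/-- The operators which commute with all operators on `A` and on `B` and which preserve the charge
of `C`. -/
def Spectates (u : ∀ x, G →* Matrix.unitaryGroup (s x) ℂ) (A B C : Finset Λ)
    (Y : Matrix (∀ x, s x) (∀ x, s x) ℂ) : Prop :=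
  (∀ M, IsSupportedOn A M → Commute Y M) ∧ (∀ M, IsSupportedOn B M → Commute Y M) ∧
    ∀ g, Commute Y (regionSymm u C g)

lemma Spectates.one (A B C : Finset Λ) : Spectates u A B C 1 :=
  ⟨fun _ _ => Commute.one_left _, fun _ _ => Commute.one_left _, fun _ => Commute.one_left _⟩

lemma Spectates.mul {A B C : Finset Λ} {Y Z : Matrix (∀ x, s x) (∀ x, s x) ℂ}
    (hY : Spectates u A B C Y) (hZ : Spectates u A B C Z) : Spectates u A B C (Y * Z) :=
  ⟨fun M hM => (hY.1 M hM).mul_left (hZ.1 M hM), fun M hM => (hY.2.1 M hM).mul_left (hZ.2.1 M hM),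
    fun g => (hY.2.2 g).mul_left (hZ.2.2 g)⟩

end Support

/-! ### Light cones of symmetric circuits -/

section LightCone

variable {Λ : Type v} [Fintype Λ] [DecidableEq Λ] [MetricSpace Λ]
variable {s : Λ → Type v} [∀ x, Fintype (s x)] [∀ x, DecidableEq (s x)]
variable {G : Type v} [CommGroup G]

lemma mem_regionBall {X : Finset Λ} {l : ℝ≥0} {y : Λ} :
    y ∈ regionBall X l ↔ ∃ x ∈ X, edist y x ≤ (l : ℝ≥0∞) := by
  simp [regionBall]

lemma subset_regionBall (X : Finset Λ) (l : ℝ≥0) : X ⊆ regionBall X l := fun x hx =>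
  mem_regionBall.2 ⟨x, hx, by simp⟩

lemma regionBall_mono (X : Finset Λ) {l l' : ℝ≥0} (h : l ≤ l') :
    regionBall X l ⊆ regionBall X l' := by
  intro y hy
  obtain ⟨x, hx, hxy⟩ := mem_regionBall.1 hy
  exact mem_regionBall.2 ⟨x, hx, hxy.trans (by exact_mod_cast h)⟩

/-- A region of diameter at most `r` which meets the ball of radius `t` lies in the ball of radius
`t + r`. -/
lemma subset_regionBall_add {X S : Finset Λ} {t r : ℝ≥0}
    (hS : ∀ x ∈ S, ∀ y ∈ S, edist x y ≤ (r : ℝ≥0∞)) (h : ¬ Disjoint S (regionBall X t)) :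
    S ⊆ regionBall X (t + r) := by
  obtain ⟨y, hyS, hy⟩ := Finset.not_disjoint_iff.1 h
  obtain ⟨x, hx, hxy⟩ := mem_regionBall.1 hy
  intro z hz
  refine mem_regionBall.2 ⟨x, hx, (edist_triangle z y x).trans ?_⟩
  rw [ENNReal.coe_add, add_comm]
  exact add_le_add hxy (hS z hz y hyS)

lemma regionDist_le {X Y : Finset Λ} {x y : Λ} (hx : x ∈ X) (hy : y ∈ Y) :
    regionDist X Y ≤ edist x y :=
  (iInf₂_le x hx).trans (iInf₂_le y hy)

lemma disjoint_regionBall {X Y : Finset Λ} {t t' : ℝ≥0}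
    (h : ((t + t' : ℝ≥0) : ℝ≥0∞) < regionDist X Y) :
    Disjoint (regionBall X t) (regionBall Y t') := by
  rw [Finset.disjoint_left]
  intro z hz hz'
  obtain ⟨x, hx, hzx⟩ := mem_regionBall.1 hz
  obtain ⟨y, hy, hzy⟩ := mem_regionBall.1 hz'
  refine absurd ((regionDist_le hx hy).trans (edist_triangle x z y)) (not_le.2 ?_)
  refine lt_of_le_of_lt ?_ h
  rw [ENNReal.coe_add, edist_comm x z]
  exact add_le_add hzx hzy

variable {u : ∀ x, G →* Matrix.unitaryGroup (s x) ℂ}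

/-- One layer is the product of the gates which meet the ball of radius `t` about `A`, those which
meet the ball about `B`, and the others.  A gate of the last kind does not connect `C` with the rest
of the system, and hence preserves the charge of `C`. -/
lemma IsSymmetricLayer.exists_factorisation {A B C : Finset Λ} {r t : ℝ≥0}
    {L : Matrix (∀ x, s x) (∀ x, s x) ℂ} (hL : IsSymmetricLayer u r L)
    (hAB : Disjoint (regionBall A (t + r)) (regionBall B (t + r)))
    (hC : ∀ x ∈ (A ∪ B ∪ C)ᶜ, ∀ y ∈ C, (r : ℝ≥0∞) < edist x y) :
    ∃ LA ∈ Matrix.unitaryGroup (∀ x, s x) ℂ, ∃ LB ∈ Matrix.unitaryGroup (∀ x, s x) ℂ,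
      ∃ Y ∈ Matrix.unitaryGroup (∀ x, s x) ℂ, L = LA * LB * Y ∧
        IsSupportedOn (regionBall A (t + r)) LA ∧ IsSupportedOn (regionBall B (t + r)) LB ∧
        Spectates u (regionBall A t) (regionBall B t) C Y := by
  obtain ⟨gates, hdis, hgates, rfl⟩ := hL
  induction gates with
  | nil =>
    exact ⟨1, one_mem _, 1, one_mem _, 1, one_mem _, by simp, .one _, .one _, .one _ _ _⟩
  | cons p gates ih =>
    rw [List.pairwise_cons] at hdis
    obtain ⟨LA, hLA, LB, hLB, Y, hY, hprod, hA, hB, hS⟩ :=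
      ih hdis.2 fun q hq => hgates q (List.mem_cons_of_mem _ hq)
    obtain ⟨hpu, hps, hpr, hpsym⟩ := hgates p List.mem_cons_self
    rw [List.map_cons, List.prod_cons]
    by_cases h1 : Disjoint p.1 (regionBall A t)
    · by_cases h2 : Disjoint p.1 (regionBall B t)
      · refine ⟨LA, hLA, LB, hLB, Y * p.2, mul_mem hY hpu, ?_, hA, hB, hS.mul ?_⟩
        · -- The gates of a layer commute with each other.
          have hcomm : Commute p.2 (gates.map Prod.snd).prod := by
            refine Commute.list_prod_right _ _ fun M hM => ?_
            obtain ⟨q, hq, rfl⟩ := List.mem_map.1 hM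
            exact hps.commute (hgates q (List.mem_cons_of_mem _ hq)).2.1 (hdis.1 q hq)
          rw [hcomm.eq, hprod, Matrix.mul_assoc]
        · refine ⟨fun M hM => hps.commute hM h1, fun M hM => hps.commute hM h2,
            commute_regionSymm hps hpsym ?_⟩
          by_contra! hc
          obtain ⟨y, hyS, hyC⟩ := Finset.not_subset.1 hc.1
          obtain ⟨z, hzS, hzC⟩ := Finset.not_disjoint_iff.1 hc.2
          refine absurd (hpr y hyS z hzS) (not_le.2 (hC y ?_ z hzC))
          have hyA : y ∉ A := fun h => Finset.disjoint_left.1 h1 hyS (subset_regionBall A t h)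
          have hyB : y ∉ B := fun h => Finset.disjoint_left.1 h2 hyS (subset_regionBall B t h)
          simp [hyA, hyB, hyC]
      · have hp := hps.mono (subset_regionBall_add hpr h2)
        refine ⟨LA, hLA, p.2 * LB, mul_mem hpu hLB, Y, hY, ?_, hA, hp.mul hB, hS⟩
        rw [hprod, ← Matrix.mul_assoc, ← Matrix.mul_assoc, ← Matrix.mul_assoc,
          (hp.commute hA hAB.symm).eq]
    · have hp := hps.mono (subset_regionBall_add hpr h1)
      refine ⟨p.2 * LA, mul_mem hpu hLA, LB, hLB, Y, hY, ?_, hp.mul hA, hB, hS⟩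
      rw [hprod]
      simp only [Matrix.mul_assoc]

/-- A symmetric circuit factorises into unitaries near `A` and near `B`, applied after a unitary
which does not affect `A`, `B` and the charge of `C`. -/
theorem IsSymmetricCircuit.exists_factorisation {A B C : Finset Λ} {R l : ℝ≥0}
    {V : Matrix (∀ x, s x) (∀ x, s x) ℂ} (hV : IsSymmetricCircuit u R V) (hRl : R ≤ l)
    (hAB : Disjoint (regionBall A l) (regionBall B l))
    (hC : ∀ x ∈ (A ∪ B ∪ C)ᶜ, ∀ y ∈ C, (R : ℝ≥0∞) < edist x y) :
    ∃ WA ∈ Matrix.unitaryGroup (∀ x, s x) ℂ, ∃ WB ∈ Matrix.unitaryGroup (∀ x, s x) ℂ,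
      ∃ Y ∈ Matrix.unitaryGroup (∀ x, s x) ℂ, V = WA * WB * Y ∧
        IsSupportedOn (regionBall A l) WA ∧ IsSupportedOn (regionBall B l) WB ∧
        Spectates u A B C Y := by
  obtain ⟨r, layers, hlayers, hR, rfl⟩ := hV
  -- The light cone grows by `r` with every layer.
  suffices H : ∃ WA ∈ Matrix.unitaryGroup (∀ x, s x) ℂ,
      ∃ WB ∈ Matrix.unitaryGroup (∀ x, s x) ℂ, ∃ Y ∈ Matrix.unitaryGroup (∀ x, s x) ℂ,
        layers.prod = WA * WB * Y ∧ IsSupportedOn (regionBall A (layers.length * r)) WA ∧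
        IsSupportedOn (regionBall B (layers.length * r)) WB ∧ Spectates u A B C Y by
    obtain ⟨WA, hWA, WB, hWB, Y, hY, hprod, hA, hB, hS⟩ := H
    exact ⟨WA, hWA, WB, hWB, Y, hY, hprod, hA.mono (regionBall_mono A (hR.trans hRl)),
      hB.mono (regionBall_mono B (hR.trans hRl)), hS⟩
  induction layers with
  | nil =>
    exact ⟨1, one_mem _, 1, one_mem _, 1, one_mem _, by simp, .one _, .one _, .one _ _ _⟩
  | cons L layers ih =>
    set t : ℝ≥0 := layers.length * r with ht
    have htr : ((L :: layers).length : ℝ≥0) * r = t + r := by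
      rw [ht, List.length_cons]; push_cast; ring
    rw [htr] at hR ⊢
    obtain ⟨WA, hWA, WB, hWB, Y, hY, hprod, hA, hB, hS⟩ :=
      ih (fun M hM => hlayers M (List.mem_cons_of_mem _ hM)) (le_self_add.trans hR)
    have hABr : Disjoint (regionBall A (t + r)) (regionBall B (t + r)) :=
      hAB.mono (regionBall_mono A (hR.trans hRl)) (regionBall_mono B (hR.trans hRl))
    obtain ⟨LA, hLA, LB, hLB, Z, hZ, hLprod, hA', hB', hS'⟩ :=
      (hlayers L List.mem_cons_self).exists_factorisation (t := t) (A := A) (B := B) (C := C)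
        hABr fun x hx y hy => lt_of_le_of_lt (by exact_mod_cast le_add_self.trans hR) (hC x hx y hy)
    refine ⟨LA * WA, mul_mem hLA hWA, LB * WB, mul_mem hLB hWB, Z * Y, mul_mem hZ hY, ?_,
      hA'.mul (hA.mono (regionBall_mono A le_self_add)),
      hB'.mul (hB.mono (regionBall_mono B le_self_add)), Spectates.mul ⟨?_, ?_, hS'.2.2⟩ hS⟩
    · have h1 : Commute Z WA := hS'.1 _ hA
      have h2 : Commute Z WB := hS'.2.1 _ hB
      have h3 : Commute LB WA := hB'.commute (hA.mono (regionBall_mono A le_self_add)) hABr.symm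
      calc (L :: layers).prod = LA * LB * (Z * WA) * (WB * Y) := by
            rw [List.prod_cons, hprod, hLprod]; simp only [Matrix.mul_assoc]
        _ = LA * (LB * WA) * (Z * WB) * Y := by rw [h1.eq]; simp only [Matrix.mul_assoc]
        _ = LA * WA * (LB * WB) * (Z * Y) := by
            rw [h2.eq, h3.eq]; simp only [Matrix.mul_assoc]
    · exact fun M hM => hS'.1 M (hM.mono (subset_regionBall A t))
    · exact fun M hM => hS'.2.1 M (hM.mono (subset_regionBall B t))

end LightCone

/-! ### Partial traces and local measurements -/

section PartialTrace

variable {Λ : Type v} [Fintype Λ] [DecidableEq Λ]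
variable {s : Λ → Type v} [∀ x, Fintype (s x)] [∀ x, DecidableEq (s x)]

/-- A configuration of the whole system is a triple of configurations of `A`, `B` and the
remaining sites. -/
def glueEquiv {A B : Finset Λ} (h : Disjoint A B) :
    (Conf s A × Conf s B) × Conf s (A ∪ B)ᶜ ≃ ∀ x, s x where
  toFun p := glue A B p.1.1 p.1.2 p.2
  invFun σ := ((fun x => σ x, fun x => σ x), fun x => σ x)
  left_inv := by
    rintro ⟨⟨a, b⟩, c⟩
    refine Prod.ext (Prod.ext ?_ ?_) ?_
    · funext x
      simp [glue]
    · funext x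
      simp [glue, Finset.disjoint_right.1 h x.2]
    · funext x
      have hx := x.2
      simp only [Finset.mem_compl, Finset.mem_union, not_or] at hx
      simp [glue, hx.1, hx.2]
  right_inv := by
    intro σ
    funext x
    simp only [glue]
    split_ifs <;> rfl

/-- The defining duality of the partial trace. -/
lemma trace_kronecker_mul_reduceTo {A B : Finset Λ} (h : Disjoint A B)
    (m : Matrix (Conf s A) (Conf s A) ℂ) (m' : Matrix (Conf s B) (Conf s B) ℂ)
    (M : Matrix (∀ x, s x) (∀ x, s x) ℂ) :
    ((m ⊗ₖ m') * reduceTo A B M).trace = (extendOp A m * extendOp B m' * M).trace := by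
  have hE : ∀ (p q : Conf s A × Conf s B) (c d : Conf s (A ∪ B)ᶜ),
      (extendOp A m * extendOp B m') (glueEquiv h (p, c)) (glueEquiv h (q, d)) =
        if c = d then m p.1 q.1 * m' p.2 q.2 else 0 := by
    intro p q c d
    rw [extendOp_mul_extendOp_apply h]
    have h1 := (glueEquiv h).left_inv (p, c)
    have h2 := (glueEquiv h).left_inv (q, d)
    have e1 : (fun x : A => glueEquiv h (p, c) x) = p.1 := congrArg (fun t => t.1.1) h1
    have e2 : (fun x : B => glueEquiv h (p, c) x) = p.2 := congrArg (fun t => t.1.2) h1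
    have e3 : (fun x : ↥(A ∪ B)ᶜ => glueEquiv h (p, c) x) = c := congrArg (fun t => t.2) h1
    have e4 : (fun x : A => glueEquiv h (q, d) x) = q.1 := congrArg (fun t => t.1.1) h2
    have e5 : (fun x : B => glueEquiv h (q, d) x) = q.2 := congrArg (fun t => t.1.2) h2
    have e6 : (fun x : ↥(A ∪ B)ᶜ => glueEquiv h (q, d) x) = d := congrArg (fun t => t.2) h2
    rw [e1, e2, e4, e5]
    congr 1
    refine propext ⟨fun hx => ?_, fun hx x h1 h2 => ?_⟩
    · rw [← e3, ← e6]
      funext x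
      have := x.2
      simp only [Finset.mem_compl, Finset.mem_union, not_or] at this
      exact hx x this.1 this.2
    · rw [← e3, ← e6] at hx
      exact congrFun hx ⟨x, by simp [h1, h2]⟩
  have hR : (extendOp A m * extendOp B m' * M).trace =
      ∑ p, ∑ c, ∑ q, ∑ d, (extendOp A m * extendOp B m') (glueEquiv h (p, c)) (glueEquiv h (q, d)) *
        M (glueEquiv h (q, d)) (glueEquiv h (p, c)) := by
    simp only [Matrix.trace, Matrix.diag_apply, Matrix.mul_apply (N := M)]
    rw [← (glueEquiv h).sum_comp, Fintype.sum_prod_type]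
    refine Finset.sum_congr rfl fun p _ => Finset.sum_congr rfl fun c _ => ?_
    rw [← (glueEquiv h).sum_comp, Fintype.sum_prod_type]
  rw [hR, Matrix.trace]
  refine Finset.sum_congr rfl fun p _ => ?_
  rw [Finset.sum_comm, Matrix.diag_apply, Matrix.mul_apply]
  refine Finset.sum_congr rfl fun q _ => ?_
  simp only [hE, ite_mul, zero_mul, Finset.sum_ite_eq, Finset.mem_univ, if_true,
    Matrix.kroneckerMap_apply, reduceTo, Finset.mul_sum]
  rfl

variable {G : Type v} [CommGroup G] {u : ∀ x, G →* Matrix.unitaryGroup (s x) ℂ}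

namespace EigenFrame

variable (F : EigenFrame u)

/-- The rank-one projection on the sites of `Z` onto the product of eigenvectors labelled by
`c`. -/
noncomputable def confProj (Z : Finset Λ) (c : Conf s Z) : Matrix (∀ x, s x) (∀ x, s x) ℂ :=
  F.op fun σ => if (fun x : Z => σ x) = c then 1 else 0

lemma confProj_eq_extendOp (Z : Finset Λ) (c : Conf s Z) :
    F.confProj Z c = extendOp Z (Matrix.of fun a b =>
      (∏ x : Z, F.basis x (a x) (c x)) * ∏ x : Z, star (F.basis x (b x) (c x))) := by
  set d : ∀ x, s x → ℂ := fun x i => if hx : x ∈ Z then if i = c ⟨x, hx⟩ then 1 else 0 else 1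
    with hd
  have h1 : (fun σ : ∀ x, s x => if (fun x : Z => σ x) = c then (1 : ℂ) else 0) =
      fun σ => ∏ x, d x (σ x) := by
    funext σ
    split_ifs with h
    · refine (Finset.prod_eq_one fun x _ => ?_).symm
      simp only [hd]
      split_ifs with hx hx'
      · rfl
      · exact absurd (congrFun h ⟨x, hx⟩) hx'
      · rfl
    · obtain ⟨x, hx⟩ := Function.ne_iff.1 h
      refine (Finset.prod_eq_zero (Finset.mem_univ x.1) ?_).symm
      simp only [hd]
      rw [dif_pos x.2, if_neg hx]
  rw [confProj, h1, F.op_prod]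
  set m := fun x => F.basis x * diagonal (d x) * (F.basis x)ᴴ with hm
  have h2 : prodOp m = prodOp fun x => if x ∈ Z then m x else 1 := by
    congr 1
    funext x
    split_ifs with hx
    · rfl
    · have : d x = fun _ => 1 := by funext i; simp [hd, hx]
      simp only [hm, this]
      rw [Matrix.diagonal_one, Matrix.mul_one, F.mul_star]
  rw [h2, ← extendOp_prod]
  congr 1
  ext a b
  simp only [Matrix.of_apply, ← Finset.prod_mul_distrib]
  refine Finset.prod_congr rfl fun x _ => ?_
  simp only [hm, Matrix.mul_apply (N := (F.basis x.1)ᴴ), Matrix.mul_diagonal, hd, dif_pos x.2,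
    Matrix.conjTranspose_apply]
  simp

lemma isSupportedOn_confProj (Z : Finset Λ) (c : Conf s Z) : IsSupportedOn Z (F.confProj Z c) := by
  rw [F.confProj_eq_extendOp]
  exact isSupportedOn_extendOp _ _

/-- The operator `1 ⊗ ⟨c|` from the region `X'` to its part `X`, where `c` labels a product of
eigenvectors on the sites of `X' \ X`. -/
noncomputable def bra {X X' : Finset Λ} (h : X ⊆ X') (c : Conf s (X' \ X)) :
    Matrix (Conf s X) (Conf s X') ℂ :=
  Matrix.of fun a σ => if a = (fun x : X => σ ⟨x, h x.2⟩) then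
    ∏ x : ↥(X' \ X), star (F.basis x (σ ⟨x, (Finset.mem_sdiff.1 x.2).1⟩) (c x)) else 0

lemma extendOp_bra_conj {X X' : Finset Λ} (h : X ⊆ X') (c : Conf s (X' \ X))
    (m : Matrix (Conf s X) (Conf s X) ℂ) :
    extendOp X' ((F.bra h c)ᴴ * m * F.bra h c) = extendOp X m * F.confProj (X' \ X) c := by
  ext σ τ
  rw [F.confProj_eq_extendOp, extendOp_mul_extendOp_apply Finset.disjoint_sdiff]
  have hc : (∀ x, x ∉ X → x ∉ X' \ X → σ x = τ x) ↔ ∀ x, x ∉ X' → σ x = τ x := by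
    refine forall_congr' fun x => ?_
    have := @h x
    simp only [Finset.mem_sdiff]
    tauto
  simp only [hc, extendOp]
  congr 1
  simp only [Matrix.mul_apply, bra, Matrix.conjTranspose_apply, Matrix.of_apply, apply_ite star,
    star_zero, ite_mul, zero_mul, mul_ite, mul_zero, Finset.sum_ite_eq', Finset.mem_univ, if_true,
    star_prod, star_star]
  ring

lemma sum_bra_conj [Nonempty (∀ x, s x)] {X X' : Finset Λ} (h : X ⊆ X') :
    ∑ c, (F.bra h c)ᴴ * F.bra h c = 1 := by
  apply extendOp_injective X'
  rw [extendOp_sum, extendOp_one]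
  have h1 : ∀ c, extendOp X' ((F.bra h c)ᴴ * F.bra h c) = F.confProj (X' \ X) c := by
    intro c
    have := F.extendOp_bra_conj h c 1
    rwa [Matrix.mul_one, extendOp_one, Matrix.one_mul] at this
  simp_rw [h1, confProj]
  rw [F.op_sum, ← F.op_one]
  congr 1
  funext σ
  simp

end EigenFrame

/-- An operator which preserves the charge of a region commutes with the charge projectors. -/
lemma commute_chargeProj {X : Finset Λ} {M : Matrix (∀ x, s x) (∀ x, s x) ℂ}
    (hM : ∀ g, Commute M (regionSymm u X g)) (κ : G →* Circle) :
    Commute M (chargeProj u X κ) := by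
  classical
  obtain ⟨F⟩ := nonempty_eigenFrame u
  set W := prodOp F.basis with hW
  -- In the eigenbasis, `M` has no matrix element between different charges.
  have hconj : ∀ d, Commute M (F.op d) ↔ Commute (Wᴴ * M * W) (diagonal d) := by
    intro d
    have hW1 : Wᴴ * W = 1 := F.basis_star_mul
    have hW2 : W * Wᴴ = 1 := F.basis_mul_star
    have e1 : Wᴴ * (M * F.op d) * W = Wᴴ * M * W * diagonal d := by
      simp only [EigenFrame.op, ← hW, Matrix.mul_assoc, hW1, Matrix.mul_one]
    have e2 : Wᴴ * (F.op d * M) * W = diagonal d * (Wᴴ * M * W) := by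
      simp only [EigenFrame.op, ← hW, ← Matrix.mul_assoc, hW1, Matrix.one_mul]
    have hcancel : ∀ N, W * (Wᴴ * N * W) * Wᴴ = N := by
      intro N
      simp only [Matrix.mul_assoc, hW2, Matrix.mul_one]
      rw [← Matrix.mul_assoc, hW2, Matrix.one_mul]
    constructor
    · intro h
      rw [Commute, SemiconjBy, ← e1, ← e2, h.eq]
    · intro h
      rw [Commute, SemiconjBy, ← e1, ← e2] at h
      rw [Commute, SemiconjBy, ← hcancel (M * F.op d), h, hcancel]
  have hentry : ∀ σ τ, (Wᴴ * M * W) σ τ ≠ 0 → F.charge X σ = F.charge X τ := by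
    intro σ τ hne
    refine MonoidHom.ext fun g => Circle.ext ?_
    have h1 := (hconj _).1 (F.regionSymm_eq_op X g ▸ hM g)
    have h2 := congrFun (congrFun h1.eq σ) τ
    rw [Matrix.mul_diagonal, Matrix.diagonal_mul, mul_comm] at h2
    exact (mul_right_cancel₀ hne h2).symm
  rw [F.chargeProj_eq_op, hconj]
  ext σ τ
  rw [Matrix.mul_diagonal, Matrix.diagonal_mul]
  by_cases hne : (Wᴴ * M * W) σ τ = 0
  · rw [hne, mul_zero, zero_mul]
  · rw [hentry σ τ hne, mul_comm]

end PartialTrace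

/-! ### The conversion -/

section Conversion

variable {Λ : Type v} [Fintype Λ] [DecidableEq Λ]
variable {s : Λ → Type v} [∀ x, Fintype (s x)] [∀ x, DecidableEq (s x)]
variable {G : Type v} [CommGroup G] {u : ∀ x, G →* Matrix.unitaryGroup (s x) ℂ}

/-- The charge of `C` is a function of its charge outside `A' ∪ B'` and of the configurations on
`A' \ A` and `B' \ B`, which contain the rest of `C`. -/
lemma EigenFrame.exists_register_relabelling (F : EigenFrame u) {A B C A' B' : Finset Λ}
    (hAC : Disjoint A C) (hBC : Disjoint B C) :
    ∃ f : Register u (C \ (A' ∪ B')) → Conf s (A' \ A) → Conf s (B' \ B) → Register u C,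
      ∀ (τ : ∀ x, s x) (κ : Register u (C \ (A' ∪ B'))), F.charge (C \ (A' ∪ B')) τ = κ.1 →
        (f κ (fun x => τ x) (fun x => τ x)).1 = F.charge C τ := by
  choose σ₀ hσ₀ using fun κ : Register u (C \ (A' ∪ B')) =>
    (F.chargeSubspace_ne_bot_iff _ κ.1).1 κ.2
  let g : Register u (C \ (A' ∪ B')) → Conf s (A' \ A) → Conf s (B' \ B) → ∀ x, s x :=
    fun κ i j x => if hx : x ∈ A' \ A then i ⟨x, hx⟩ else
      if hx : x ∈ B' \ B then j ⟨x, hx⟩ else σ₀ κ x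
  refine ⟨fun κ i j => ⟨F.charge C (g κ i j), (F.chargeSubspace_ne_bot_iff _ _).2 ⟨_, rfl⟩⟩, ?_⟩
  intro τ κ hκ
  set σ := g κ (fun x => τ x) (fun x => τ x) with hσ
  have hC : C = (C \ (A' ∪ B')) ∪ (C ∩ (A' ∪ B')) := (Finset.sdiff_union_inter _ _).symm
  have hd : Disjoint (C \ (A' ∪ B')) (C ∩ (A' ∪ B')) := Finset.disjoint_sdiff_inter _ _
  have h1 : F.charge (C \ (A' ∪ B')) σ = F.charge (C \ (A' ∪ B')) τ := by
    rw [hκ, ← hσ₀ κ]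
    refine F.charge_congr fun x hx => ?_
    simp only [Finset.mem_sdiff, Finset.mem_union, not_or] at hx
    simp [hσ, g, hx.2.1, hx.2.2]
  have h2 : F.charge (C ∩ (A' ∪ B')) σ = F.charge (C ∩ (A' ∪ B')) τ := by
    refine F.charge_congr fun x hx => ?_
    simp only [Finset.mem_inter, Finset.mem_union] at hx
    have hxA : x ∉ A := Finset.disjoint_right.1 hAC hx.1
    have hxB : x ∉ B := Finset.disjoint_right.1 hBC hx.1
    by_cases hx' : x ∈ A'
    · simp [hσ, g, hx', hxA]
    · simp [hσ, g, hx', hx.2.resolve_left hx', hxB]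
  change F.charge C σ = F.charge C τ
  rw [hC, F.charge_union hd, F.charge_union hd, h1, h2]

/-- The outcomes of total charge `κ` resolve the charge projector of `C`: all the projections are
diagonal in the same eigenbasis. -/
lemma sum_ite_confProj_mul_chargeProj (F : EigenFrame u) {A B C A' B' : Finset Λ}
    (f : Register u (C \ (A' ∪ B')) → Conf s (A' \ A) → Conf s (B' \ B) → Register u C)
    (hf : ∀ (τ : ∀ x, s x) (κ : Register u (C \ (A' ∪ B'))), F.charge (C \ (A' ∪ B')) τ = κ.1 →
        (f κ (fun x => τ x) (fun x => τ x)).1 = F.charge C τ) (κ : Register u C) :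
    ∑ c, ∑ i, ∑ j, (if f c i j = κ then F.confProj (A' \ A) i * F.confProj (B' \ B) j *
      chargeProj u (C \ (A' ∪ B')) c.1 else 0) = chargeProj u C κ.1 := by
  classical
  have h : ∀ c i j, (if f c i j = κ then F.confProj (A' \ A) i * F.confProj (B' \ B) j *
      chargeProj u (C \ (A' ∪ B')) c.1 else 0) = F.op fun σ =>
        if (fun x : ↥(B' \ B) => σ x) = j then if (fun x : ↥(A' \ A) => σ x) = i then
          if F.charge (C \ (A' ∪ B')) σ = c.1 then if f c i j = κ then 1 else 0 else 0 else 0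
        else 0 := by
    intro c i j
    split_ifs with h
    · rw [F.chargeProj_eq_op, EigenFrame.confProj, EigenFrame.confProj, F.op_mul, F.op_mul]
      congr 1
      funext σ
      split_ifs <;> simp
    · have := F.op_smul 0 1
      simp only [zero_mul, zero_smul] at this
      simpa using this.symm
  simp_rw [h, F.op_sum]
  rw [F.chargeProj_eq_op]
  congr 1
  funext σ
  simp only [Finset.sum_ite_eq, Finset.mem_univ, if_true]
  rw [Finset.sum_eq_single
    ⟨F.charge (C \ (A' ∪ B')) σ, (F.chargeSubspace_ne_bot_iff _ _).2 ⟨σ, rfl⟩⟩]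
  · have h1 := hf σ ⟨F.charge (C \ (A' ∪ B')) σ, (F.chargeSubspace_ne_bot_iff _ _).2 ⟨σ, rfl⟩⟩ rfl
    rw [if_pos rfl, ← h1]
    exact if_congr Subtype.ext_iff rfl rfl
  · intro c _ hc
    rw [if_neg fun h => hc (Subtype.ext h.symm)]
  · exact fun h => absurd (Finset.mem_univ _) h

/-- Unitarity is inherited by the local factor of a supported operator. -/
lemma exists_unitary_extendOp [Nonempty (∀ x, s x)] {X : Finset Λ}
    {M : Matrix (∀ x, s x) (∀ x, s x) ℂ} (hM : IsSupportedOn X M)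
    (hu : M ∈ Matrix.unitaryGroup (∀ x, s x) ℂ) :
    ∃ w : Matrix (Conf s X) (Conf s X) ℂ, w * wᴴ = 1 ∧ M = extendOp X w := by
  obtain ⟨w, rfl⟩ := hM
  refine ⟨w, extendOp_injective X ?_, rfl⟩
  rw [← extendOp_mul, extendOp_conjTranspose, extendOp_one]
  exact Matrix.mem_unitaryGroup_iff.1 hu

/-- Undoing local unitaries under the trace: conjugating the observables `E₁`, `E₂` by commuting
unitaries `W₁`, `W₂` amounts to removing these unitaries from the state. -/
lemma trace_conj_mul_of_commute {n : Type*} [Fintype n] [DecidableEq n]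
    {W₁ W₂ E₁ E₂ P σ : Matrix n n ℂ} (h₁ : W₁ᴴ * W₁ = 1) (h₂ : W₂ᴴ * W₂ = 1)
    (hW : Commute W₁ W₂) (hW' : Commute W₁ᴴ W₂) (hE₁ : Commute E₁ W₂) (hE₂ : Commute W₁ᴴ E₂)
    (hP₁ : Commute P W₁) (hP₂ : Commute P W₂) :
    (W₁ * E₁ * W₁ᴴ * (W₂ * E₂ * W₂ᴴ) * (P * (W₁ * W₂ * σ * (W₁ * W₂)ᴴ))).trace =
      (E₁ * E₂ * P * σ).trace := by
  have e : W₁ * E₁ * W₁ᴴ * (W₂ * E₂ * W₂ᴴ) * (P * (W₁ * W₂ * σ * (W₁ * W₂)ᴴ)) =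
      (W₁ * W₂) * (E₁ * E₂ * P * σ * (W₁ * W₂)ᴴ) := by
    calc W₁ * E₁ * W₁ᴴ * (W₂ * E₂ * W₂ᴴ) * (P * (W₁ * W₂ * σ * (W₁ * W₂)ᴴ))
        = W₁ * E₁ * (W₁ᴴ * W₂) * E₂ * W₂ᴴ * ((P * W₁) * W₂ * σ * (W₁ * W₂)ᴴ) := by
          simp only [Matrix.mul_assoc]
      _ = W₁ * (E₁ * W₂) * (W₁ᴴ * E₂) * W₂ᴴ * ((W₁ * (P * W₂)) * σ * (W₁ * W₂)ᴴ) := by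
          rw [hW'.eq, hP₁.eq]; simp only [Matrix.mul_assoc]
      _ = W₁ * W₂ * E₁ * E₂ * W₁ᴴ * W₂ᴴ * ((W₁ * W₂) * P * σ * (W₁ * W₂)ᴴ) := by
          rw [hE₁.eq, hE₂.eq, hP₂.eq]; simp only [Matrix.mul_assoc]
      _ = W₁ * W₂ * E₁ * E₂ * (W₁ᴴ * (W₂ᴴ * W₂) * W₁) * P * σ * (W₁ * W₂)ᴴ := by
          rw [hW.eq]; simp only [Matrix.mul_assoc]
      _ = _ := by
          rw [h₂, Matrix.mul_one, h₁, Matrix.mul_one]; simp only [Matrix.mul_assoc]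
  rw [e, Matrix.trace_mul_comm]
  congr 1
  rw [Matrix.mul_assoc, Matrix.conjTranspose_mul, Matrix.mul_assoc W₂ᴴ, ← Matrix.mul_assoc W₁ᴴ, h₁,
    Matrix.one_mul, h₂, Matrix.mul_one]

/-- One outcome of the protocol on a state `W₁ W₂ σ (W₁ W₂)ᴴ`, tested against a product operator: the
parties undo the local unitaries `W₁`, `W₂` and measure the sites of `A' \ A` and `B' \ B` in the
eigenbasis of the symmetry. -/
lemma trace_bra_conj_reduceTo (F : EigenFrame u) {A B X A' B' : Finset Λ} (hA : A ⊆ A')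
    (hB : B ⊆ B') (hAB : Disjoint A' B') (hAX : Disjoint A' X) (hBX : Disjoint B' X)
    {w₁ : Matrix (Conf s A') (Conf s A') ℂ} {w₂ : Matrix (Conf s B') (Conf s B') ℂ}
    (h₁ : w₁ * w₁ᴴ = 1) (h₂ : w₂ * w₂ᴴ = 1) (σ : Matrix (∀ x, s x) (∀ x, s x) ℂ) (κ : G →* Circle)
    (i : Conf s (A' \ A)) (j : Conf s (B' \ B)) (m : Matrix (Conf s A) (Conf s A) ℂ)
    (m' : Matrix (Conf s B) (Conf s B) ℂ) :
    ((m ⊗ₖ m') * (((F.bra hA i * w₁ᴴ) ⊗ₖ (F.bra hB j * w₂ᴴ)) *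
      reduceTo A' B' (chargeProj u X κ * (extendOp A' w₁ * extendOp B' w₂ * σ *
        (extendOp A' w₁ * extendOp B' w₂)ᴴ)) *
      ((F.bra hA i * w₁ᴴ) ⊗ₖ (F.bra hB j * w₂ᴴ))ᴴ)).trace =
    ((extendOp A m * extendOp B m') * (F.confProj (A' \ A) i * F.confProj (B' \ B) j *
      chargeProj u X κ) * σ).trace := by
  set W₁ := extendOp A' w₁ with hW₁
  set W₂ := extendOp B' w₂ with hW₂
  have sA : IsSupportedOn A' W₁ := isSupportedOn_extendOp _ _
  have sB : IsSupportedOn B' W₂ := isSupportedOn_extendOp _ _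
  have u₁ : W₁ᴴ * W₁ = 1 := by
    rw [hW₁, ← extendOp_conjTranspose, extendOp_mul, mul_eq_one_comm.1 h₁, extendOp_one]
  have u₂ : W₂ᴴ * W₂ = 1 := by
    rw [hW₂, ← extendOp_conjTranspose, extendOp_mul, mul_eq_one_comm.1 h₂, extendOp_one]
  rw [← Matrix.mul_assoc, Matrix.trace_mul_comm, ← Matrix.mul_assoc, ← Matrix.mul_assoc,
    Matrix.conjTranspose_kronecker, ← Matrix.mul_kronecker_mul, ← Matrix.mul_kronecker_mul,
    trace_kronecker_mul_reduceTo hAB]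
  have k₁ : extendOp A' ((F.bra hA i * w₁ᴴ)ᴴ * m * (F.bra hA i * w₁ᴴ)) =
      W₁ * (extendOp A m * F.confProj (A' \ A) i) * W₁ᴴ := by
    rw [← F.extendOp_bra_conj hA, hW₁, ← extendOp_conjTranspose, extendOp_mul, extendOp_mul]
    simp only [Matrix.conjTranspose_mul, Matrix.conjTranspose_conjTranspose, Matrix.mul_assoc]
  have k₂ : extendOp B' ((F.bra hB j * w₂ᴴ)ᴴ * m' * (F.bra hB j * w₂ᴴ)) =
      W₂ * (extendOp B m' * F.confProj (B' \ B) j) * W₂ᴴ := by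
    rw [← F.extendOp_bra_conj hB, hW₂, ← extendOp_conjTranspose, extendOp_mul, extendOp_mul]
    simp only [Matrix.conjTranspose_mul, Matrix.conjTranspose_conjTranspose, Matrix.mul_assoc]
  have s₁ : IsSupportedOn A' (extendOp A m * F.confProj (A' \ A) i) :=
    ((isSupportedOn_extendOp A m).mono hA).mul
      ((F.isSupportedOn_confProj _ i).mono Finset.sdiff_subset)
  have s₂ : IsSupportedOn B' (extendOp B m' * F.confProj (B' \ B) j) :=
    ((isSupportedOn_extendOp B m').mono hB).mul
      ((F.isSupportedOn_confProj _ j).mono Finset.sdiff_subset)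
  have hcomm : Commute (F.confProj (A' \ A) i) (extendOp B m') :=
    (F.isSupportedOn_confProj _ i).commute (isSupportedOn_extendOp B m')
      (hAB.mono Finset.sdiff_subset hB)
  have hprod : extendOp A m * F.confProj (A' \ A) i * (extendOp B m' * F.confProj (B' \ B) j) =
      extendOp A m * extendOp B m' * (F.confProj (A' \ A) i * F.confProj (B' \ B) j) := by
    rw [Matrix.mul_assoc, ← Matrix.mul_assoc _ (extendOp B m'), hcomm.eq]
    simp only [Matrix.mul_assoc]
  rw [k₁, k₂, trace_conj_mul_of_commute u₁ u₂ (sA.commute sB hAB)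
    (sA.conjTranspose.commute sB hAB) (s₁.commute sB hAB) (sA.conjTranspose.commute s₂ hAB)
    (commute_chargeProj (fun g => sA.commute (isSupportedOn_regionSymm _ g) hAX) _).symm
    (commute_chargeProj (fun g => sB.commute (isSupportedOn_regionSymm _ g) hBX) _).symm, hprod,
    ← Matrix.mul_assoc _ _ (chargeProj u X κ)]

/-- The blocks of the final state: the outcomes with total charge `κ` leave the partial trace of
`Π_κ ρ`. -/
lemma sum_bra_conj_reduceTo (F : EigenFrame u) {A B C A' B' : Finset Λ} (hA : A ⊆ A')
    (hB : B ⊆ B') (hAB' : Disjoint A' B')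
    (f : Register u (C \ (A' ∪ B')) → Conf s (A' \ A) → Conf s (B' \ B) → Register u C)
    (hf : ∀ (τ : ∀ x, s x) (κ : Register u (C \ (A' ∪ B'))), F.charge (C \ (A' ∪ B')) τ = κ.1 →
        (f κ (fun x => τ x) (fun x => τ x)).1 = F.charge C τ)
    {w₁ : Matrix (Conf s A') (Conf s A') ℂ} {w₂ : Matrix (Conf s B') (Conf s B') ℂ}
    {Y : Matrix (∀ x, s x) (∀ x, s x) ℂ}
    (h₁ : w₁ * w₁ᴴ = 1) (h₂ : w₂ * w₂ᴴ = 1) (hY : Yᴴ * Y = 1) (hS : Spectates u A B C Y)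
    (ρ : Matrix (∀ x, s x) (∀ x, s x) ℂ) (κ : Register u C) :
    ∑ c, ∑ i, ∑ j, (if f c i j = κ then
      ((F.bra hA i * w₁ᴴ) ⊗ₖ (F.bra hB j * w₂ᴴ)) *
        reduceTo A' B' (chargeProj u (C \ (A' ∪ B')) c.1 * (extendOp A' w₁ * extendOp B' w₂ *
          (Y * ρ * Yᴴ) * (extendOp A' w₁ * extendOp B' w₂)ᴴ)) *
        ((F.bra hA i * w₁ᴴ) ⊗ₖ (F.bra hB j * w₂ᴴ))ᴴ else 0) =
      reduceTo A B (chargeProj u C κ.1 * ρ) := by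
  have hAB : Disjoint A B := hAB'.mono hA hB
  have dA : Disjoint A' (C \ (A' ∪ B')) := Finset.disjoint_left.2 fun x hx hx' =>
    (Finset.mem_sdiff.1 hx').2 (Finset.mem_union_left _ hx)
  have dB : Disjoint B' (C \ (A' ∪ B')) := Finset.disjoint_left.2 fun x hx hx' =>
    (Finset.mem_sdiff.1 hx').2 (Finset.mem_union_right _ hx)
  ext p q
  -- Test both sides against the matrix unit `|q⟩⟨p|`, a product operator.
  have htest : ∀ N : Matrix (Conf s A × Conf s B) (Conf s A × Conf s B) ℂ, N p q =
      ((Matrix.single q.1 p.1 (1 : ℂ) ⊗ₖ Matrix.single q.2 p.2 (1 : ℂ)) * N).trace := by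
    intro N
    rw [Matrix.single_kronecker_single, Matrix.trace_single_mul]
    simp
  refine (htest _).trans ?_
  rw [htest (reduceTo A B _), trace_kronecker_mul_reduceTo hAB]
  generalize Matrix.single q.1 p.1 (1 : ℂ) = m
  generalize Matrix.single q.2 p.2 (1 : ℂ) = m'
  have hsum : ∀ c i j,
      ((m ⊗ₖ m') * (if f c i j = κ then
        ((F.bra hA i * w₁ᴴ) ⊗ₖ (F.bra hB j * w₂ᴴ)) *
        reduceTo A' B' (chargeProj u (C \ (A' ∪ B')) c.1 * (extendOp A' w₁ * extendOp B' w₂ *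
          (Y * ρ * Yᴴ) * (extendOp A' w₁ * extendOp B' w₂)ᴴ)) *
        ((F.bra hA i * w₁ᴴ) ⊗ₖ (F.bra hB j * w₂ᴴ))ᴴ else 0)).trace =
      ((extendOp A m * extendOp B m') * (if f c i j = κ then F.confProj (A' \ A) i *
        F.confProj (B' \ B) j * chargeProj u (C \ (A' ∪ B')) c.1 else 0) *
        (Y * ρ * Yᴴ)).trace := by
    intro c i j
    split_ifs
    · exact trace_bra_conj_reduceTo F hA hB hAB' dA dB h₁ h₂ _ c.1 i j m m'
    · simp only [Matrix.mul_zero, Matrix.zero_mul, Matrix.trace_zero]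
  simp only [Matrix.mul_sum, Matrix.trace_sum, hsum]
  simp only [← Matrix.trace_sum, ← Matrix.sum_mul, ← Matrix.mul_sum]
  rw [sum_ite_confProj_mul_chargeProj F f hf κ]
  -- Finally remove `Y`, which commutes with everything that is tested.
  have hYc : Commute Y (extendOp A m * extendOp B m' * chargeProj u C κ.1) :=
    ((hS.1 _ (isSupportedOn_extendOp A m)).mul_right
      (hS.2.1 _ (isSupportedOn_extendOp B m'))).mul_right (commute_chargeProj hS.2.2 κ.1)
  rw [← Matrix.mul_assoc, ← Matrix.mul_assoc, ← hYc.eq, Matrix.mul_assoc Y, Matrix.mul_assoc Y,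
    Matrix.trace_mul_comm, Matrix.mul_assoc _ Yᴴ, hY, Matrix.mul_one, Matrix.mul_assoc]

end Conversion

theorem mainTheorem2 {Λ : Type v} [Fintype Λ] [DecidableEq Λ] [MetricSpace Λ]
    {s : Λ → Type v} [∀ x, Fintype (s x)] [∀ x, DecidableEq (s x)]
    {G : Type v} [CommGroup G] (u : ∀ x, G →* Matrix.unitaryGroup (s x) ℂ)
    (A B C D : Finset Λ) (hAB : Disjoint A B) (hAC : Disjoint A C) (hBC : Disjoint B C)
    (hD : D = (A ∪ B ∪ C)ᶜ)
    (R : ℝ≥0) (V : Matrix (∀ x, s x) (∀ x, s x) ℂ) (hV : IsSymmetricCircuit u R V)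
    (hDC : D.Nonempty → 2 * (R : ℝ≥0∞) < regionDist D C)
    (l : ℝ≥0) (hRl : 2 * R < l) (hl : (l : ℝ≥0∞) < regionDist A B / 2)
    (ρ : Matrix (∀ x, s x) (∀ x, s x) ℂ) (hρ : IsState ρ) :
    LOCCConvertible
        (registerLeft (Omega u (regionBall A l) (regionBall B l)
          (C \ (regionBall A l ∪ regionBall B l)) (V * ρ * Vᴴ)))
        (registerLeft (Omega u A B C ρ)) ∧
      LOCCConvertible
        (registerRight (Omega u (regionBall A l) (regionBall B l)
          (C \ (regionBall A l ∪ regionBall B l)) (V * ρ * Vᴴ)))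
        (registerRight (Omega u A B C ρ)) := by
  classical
  obtain ⟨F⟩ := nonempty_eigenFrame u
  have hne : Nonempty (∀ x, s x) := by
    by_contra h
    rw [not_nonempty_iff] at h
    have := hρ.2
    simp [Matrix.trace] at this
  have hdis : Disjoint (regionBall A l) (regionBall B l) := by
    refine disjoint_regionBall ?_
    have := (ENNReal.lt_div_iff_mul_lt (Or.inl two_ne_zero) (Or.inl ENNReal.ofNat_ne_top)).1 hl
    rwa [mul_two, ← ENNReal.coe_add] at this
  have hR2 : R ≤ 2 * R := by rw [two_mul]; exact le_self_add
  have hgap : ∀ x ∈ (A ∪ B ∪ C)ᶜ, ∀ y ∈ C, (R : ℝ≥0∞) < edist x y := by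
    intro x hx y hy
    rw [← hD] at hx
    refine lt_of_le_of_lt ?_ ((hDC ⟨x, hx⟩).trans_le (regionDist_le hx hy))
    exact_mod_cast hR2
  obtain ⟨W₁, hW₁, W₂, hW₂, Y, hY, rfl, hs₁, hs₂, hS⟩ :=
    hV.exists_factorisation (hR2.trans hRl.le) hdis hgap
  obtain ⟨w₁, h₁, rfl⟩ := exists_unitary_extendOp hs₁ hW₁
  obtain ⟨w₂, h₂, rfl⟩ := exists_unitary_extendOp hs₂ hW₂
  have hstate : extendOp (regionBall A l) w₁ * extendOp (regionBall B l) w₂ * Y * ρ *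
      (extendOp (regionBall A l) w₁ * extendOp (regionBall B l) w₂ * Y)ᴴ =
      extendOp (regionBall A l) w₁ * extendOp (regionBall B l) w₂ * (Y * ρ * Yᴴ) *
        (extendOp (regionBall A l) w₁ * extendOp (regionBall B l) w₂)ᴴ := by
    rw [Matrix.conjTranspose_mul _ Y]
    simp only [Matrix.mul_assoc]
  rw [hstate]
  have hA := subset_regionBall A l
  have hB := subset_regionBall B l
  obtain ⟨f, hf⟩ := F.exists_register_relabelling (A' := regionBall A l) (B' := regionBall B l)
    hAC hBC
  -- A measurement remains one after a unitary has been undone.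
  have hiso : ∀ {n n' ι : Type v} [Fintype n] [DecidableEq n] [Fintype n'] [Fintype ι]
      (J : ι → Matrix n' n ℂ) (w : Matrix n n ℂ), w * wᴴ = 1 → ∑ i, (J i)ᴴ * J i = 1 →
      ∑ i, (J i * wᴴ)ᴴ * (J i * wᴴ) = 1 := by
    intro n n' ι _ _ _ _ J w hw hJ
    have : ∀ i, (J i * wᴴ)ᴴ * (J i * wᴴ) = w * ((J i)ᴴ * J i) * wᴴ := by
      intro i
      simp only [Matrix.conjTranspose_mul, Matrix.conjTranspose_conjTranspose, Matrix.mul_assoc]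
    simp_rw [this]
    rw [← Matrix.sum_mul, ← Matrix.mul_sum, hJ, Matrix.mul_one, hw]
  have key := locc_measure_and_relabel
    (fun c : Register u (C \ (regionBall A l ∪ regionBall B l)) =>
      reduceTo (regionBall A l) (regionBall B l)
        (chargeProj u (C \ (regionBall A l ∪ regionBall B l)) c.1 *
        (extendOp _ w₁ * extendOp _ w₂ * (Y * ρ * Yᴴ) * (extendOp _ w₁ * extendOp _ w₂)ᴴ)))
    (fun i => F.bra hA i * w₁ᴴ) (fun j => F.bra hB j * w₂ᴴ)
    (hiso _ _ h₁ (F.sum_bra_conj hA)) (hiso _ _ h₂ (F.sum_bra_conj hB)) f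
  have hΩ : Omega u A B C ρ = ∑ c, ∑ i, ∑ j, Matrix.single (f c i j) (f c i j) (1 : ℂ) ⊗ₖ
      (((F.bra hA i * w₁ᴴ) ⊗ₖ (F.bra hB j * w₂ᴴ)) * reduceTo (regionBall A l) (regionBall B l)
        (chargeProj u (C \ (regionBall A l ∪ regionBall B l)) c.1 *
        (extendOp _ w₁ * extendOp _ w₂ * (Y * ρ * Yᴴ) * (extendOp _ w₁ * extendOp _ w₂)ᴴ)) *
        ((F.bra hA i * w₁ᴴ) ⊗ₖ (F.bra hB j * w₂ᴴ))ᴴ) := by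
    ext ⟨κ, p⟩ ⟨κ', q⟩
    have hblock := fun κ => congrFun (congrFun (sum_bra_conj_reduceTo F hA hB hdis f hf h₁ h₂
      (Matrix.mem_unitaryGroup_iff'.1 hY) hS ρ κ) p) q
    simp only [Omega, Matrix.sum_apply, Matrix.kroneckerMap_apply, Matrix.single_apply,
      ite_mul, one_mul, zero_mul]
    simp only [Matrix.sum_apply, apply_ite (fun N : Matrix _ _ ℂ => N p q), Matrix.zero_apply]
      at hblock
    by_cases hκ : κ = κ'
    · subst hκ
      simp only [and_self, Finset.sum_ite_eq', Finset.mem_univ, if_true]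
      exact (hblock κ).symm
    · have : ∀ κ₀ : Register u C, ¬(κ₀ = κ ∧ κ₀ = κ') := fun κ₀ h => hκ (h.1.symm.trans h.2)
      simp [this]
  rw [hΩ]
  exact key
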